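/- **Setting.** $K\ge1$ devices hold differentiable local objectives $F_k:\mathbb R^{D\times d}\to\mathbb R$, with global objective $F=\frac1K\sum_{k}F_k$ (in distributed PCA, $F_k(\mathbf W)$ is the average of $\|\mathbf x-\mathbf W\mathbf W^T\mathbf x\|^2$ over the data of device $k$). Matrices carry the Frobenius norm, and $Dd=2c$ with $c\ge1$; a fixed pairing of the entries of a matrix into real and imaginary parts identifies $\mathbb R^{D\times d}$ with $\mathbb C^c$, and $g_k(\mathbf W),g(\mathbf W)\in\mathbb C^c$ denote the vectors so obtained from $\nabla F_k(\mathbf W),\nabla F(\mathbf W)$. Let $\mathcal H=\nabla^2F$ and let $\lambda_{\min}$ be the smallest eigenvalue. The constants $\alpha,\beta,\gamma,\delta,\epsilon,\chi,\nu,\sigma$ are positive, $\kappa\ge0$, $G\ge0$, $0<P_{\min}\le P_{\max}$, $\eta\in\mathbb C$. *Assumptions.* (i) $F$ is $(\alpha,\gamma,\epsilon,\delta)$-strict saddle: it is twice differentiable and every $\mathbf W$ satisfies $\|\nabla F(\mathbf W)\|\ge\epsilon$, or $\lambda_{\min}(\mathcal H(\mathbf W))\le-\gamma$, or $\|\mathbf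 W-\mathbf W^\star\|\le\delta$ for a global minimum point $\mathbf W^\star$ of $F$ with $\lambda_{\min}(\mathcal H)\ge\alpha$ on the whole $\delta$-ball around $\mathbf W^\star$. (ii) $|F|\le B$, $\|\nabla F\|\le C$, $\nabla F$ is $\beta$-Lipschitz and $\mathcal H$ is $\chi$-Lipschitz. (iii) The data noise $\boldsymbol\Delta_k(\mathbf W)=g_k(\mathbf W)-g(\mathbf W)$ satisfies $\frac1K\sum_k\boldsymbol\Delta_k(\mathbf W)\boldsymbol\Delta_k(\mathbf W)^H\preceq\kappa^2\mathbf I$ for all $\mathbf W$. The global-optimum region $\mathcal R_{\rm op}$ is the set of $\mathbf W$ with $\|\mathbf W-\mathbf W^\star\|\le\delta$ for some global minimum point $\mathbf W^\star$ and $\lambda_{\min}(\mathcal H(\mathbf W))\ge\alpha$. *AirPCA.* Start from an arbitrary $\mathbf W_0$. In round $n\ge0$ the $i$-th of the $c$ symbols is sent over one of $M$ sub-channels (by a fixed assignment), on which device $k$ has gain $h_{k,n}^{(i)}$. Device $k$ transmits the symbol $([g_k(\mathbf W_n)]_i-\eta)/\nu$ precoded by $\sqrt{P_n}/h_{k,n}^{(i)}$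 if $|h_{k,n}^{(i)}|^2\ge G$, and by $0$ otherwise; $K_n^{(i)}$ is the number of devices that are not truncated. The server receives the sum over the devices of gain times precoder times symbol, plus noise $[\mathbf z_n]_i$; denoting it $[\mathbf y_n]_i$, it forms $[\widehat g_n]_i=\frac{1}{K_n^{(i)}}\frac{\nu}{\sqrt{P_n}}[\mathbf y_n]_i+\eta$ and updates $\mathbf W_{n+1}=\mathbf W_n-\mu\,\widehat g_n$ (de-vectorized). The gains on each sub-channel and round are independent $\mathcal{CN}(0,1)$ over the devices, conditioned on at least one device being active; the $[\mathbf z_n]_i$ are $\mathcal{CN}(0,\sigma^2)$; gains of distinct sub-channels or rounds and all noise variables are independent. The receive powers satisfy $P_n\in[P_{\min},P_{\max}]$, and $P_n$ may depend on the gains and noise of rounds before $n$. *Constants.* With $\zeta=\Pr(|h|^2\ge G)$ for $h\sim\mathcal{CN}(0,1)$ (that is, $e^{-G}$), let $$V_{\max}=\frac{\kappa^2}{K\zeta}+\frac{3\nu^2\sigma^2}{K^2\zeta^2P_{\min}},\quad V_{\min}=\frac{\nu^2\sigma^2}{K^2P_{\max}},\quad N_{\max}=\frac{1}{2\mu\gamma}\log\Big(6c\frac{V_{\max}}{V_{\min}}+1\Big),\quad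 \rho=\min\Big\{\frac{2\beta c}{\gamma}\log\Big(6c\frac{V_{\max}}{V_{\min}}+1\Big),\,1\Big\}.$$ **Theorem.** There is $\theta>0$, depending only on $D,d,c,K,M,G,\kappa,\nu,\sigma,P_{\min},P_{\max},\alpha,\beta,\gamma,\delta,\epsilon,\chi,B,C$, such that the following holds for all objectives, channels, power-control sequences and initial points as above and every step size $\mu>0$ with $\mu\le\theta/(cV_{\max})$ (the meaning of $\mu\ll 1/(cV_{\max})$) and $\mu<\epsilon^2/(4\beta cV_{\max})$. For $N=mN_{\max}$, $m\in\mathbb N^+$, let $\mathcal E_N$ be the event that $\mathbf W_n\in\mathcal R_{\rm op}$ for some integer $n$ with $0\le n\le N-1$. Then $$\Pr(\mathcal E_N)\ \ge\ 1-\frac{12B}{(m+1)\,\mu\,\rho\,V_{\max}}\qquad\text{for every } m\in\mathbb N^+ .$$ Hence $\Pr(\mathcal E_{mN_{\max}})\to1$ as $m\to\infty$, and almost surely $\mathbf W_n\in\mathcal R_{\rm op}$ for some $n$. -/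

import Mathlib

open MeasureTheory ProbabilityTheory Filter Topology
open scoped ComplexOrder

noncomputable section

namespace AirPCA

/-! ### Objective functions on the space of `D × d` real matrices -/

/-- The space of `D × d` real matrices with the Frobenius inner product and norm. -/
abbrev Mat (D d : ℕ) : Type := EuclideanSpace ℝ (Fin D × Fin d)

/-- The Hessian of `F` at `W`, as the derivative of the gradient. -/
def hessian {D d : ℕ} (F : Mat D d → ℝ) (W : Mat D d) : Mat D d →L[ℝ] Mat D d :=
  fderiv ℝ (gradient F) W

/-- The smallest eigenvalue of an operator (applied to Hessians, which are symmetric). -/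
def minEigenvalue {D d : ℕ} (T : Mat D d →L[ℝ] Mat D d) : ℝ :=
  sInf {t : ℝ | Module.End.HasEigenvalue (T : Mat D d →ₗ[ℝ] Mat D d) t}

/-- `Wstar` is a point of global minimum of `F`. -/
def IsGlobalMin {D d : ℕ} (F : Mat D d → ℝ) (Wstar : Mat D d) : Prop :=
  ∀ W, F Wstar ≤ F W

/-- `(α, γ, ε, δ)`-strict saddle functions. -/
structure IsStrictSaddle {D d : ℕ} (α γ ε δ : ℝ) (F : Mat D d → ℝ) : Prop where
  differentiable : Differentiable ℝ F
  differentiable_gradient : Differentiable ℝ (gradient F)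
  trichotomy : ∀ W, ε ≤ ‖gradient F W‖ ∨ minEigenvalue (hessian F W) ≤ -γ ∨
    ∃ Wstar, IsGlobalMin F Wstar ∧ ‖W - Wstar‖ ≤ δ ∧
      ∀ W', ‖W' - Wstar‖ ≤ δ → α ≤ minEigenvalue (hessian F W')

/-- The global-optimum region. -/
def optRegion {D d : ℕ} (α δ : ℝ) (F : Mat D d → ℝ) : Set (Mat D d) :=
  {W | ∃ Wstar, IsGlobalMin F Wstar ∧ ‖W - Wstar‖ ≤ δ ∧ α ≤ minEigenvalue (hessian F W)}

/-- Boundedness of the function and of its gradient, Lipschitz gradient, Lipschitz Hessian. -/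
structure IsRegular {D d : ℕ} (B C β χ : ℝ) (F : Mat D d → ℝ) : Prop where
  bounded : ∀ W, ‖F W‖ ≤ B
  gradient_bounded : ∀ W, ‖gradient F W‖ ≤ C
  smooth : ∀ W₁ W₂, ‖gradient F W₁ - gradient F W₂‖ ≤ β * ‖W₁ - W₂‖
  hessian_smooth : ∀ W₁ W₂, ‖hessian F W₁ - hessian F W₂‖ ≤ χ * ‖W₁ - W₂‖

/-- The global objective: the average of the local objectives of the `K` devices. -/
def globalObj {D d K : ℕ} (Fk : Fin K → Mat D d → ℝ) (W : Mat D d) : ℝ :=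
  (1 / (K : ℝ)) * ∑ k, Fk k W

/-! ### Complex vectorization -/

/-- Complex vectorization: the `2c` real entries are the real and imaginary parts of `c` complex
numbers; `e` says which entry goes where. -/
def cvec {D d c : ℕ} (e : Fin D × Fin d ≃ Fin c × Fin 2) (A : Mat D d) : Fin c → ℂ :=
  fun i => ⟨A (e.symm (i, 0)), A (e.symm (i, 1))⟩

/-- De-vectorization, the inverse of `cvec e`. -/
def uncvec {D d c : ℕ} (e : Fin D × Fin d ≃ Fin c × Fin 2) (y : Fin c → ℂ) : Mat D d :=
  WithLp.toLp 2 (fun p => if (e p).2 = 0 then (y (e p).1).re else (y (e p).1).im)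

theorem uncvec_cvec {D d c : ℕ} (e : Fin D × Fin d ≃ Fin c × Fin 2) (A : Mat D d) :
    uncvec e (cvec e A) = A := by
  ext p
  obtain ⟨⟨i, j⟩, rfl⟩ := e.symm.surjective p
  fin_cases j <;> simp [uncvec, cvec]

theorem cvec_uncvec {D d c : ℕ} (e : Fin D × Fin d ≃ Fin c × Fin 2) (y : Fin c → ℂ) :
    cvec e (uncvec e y) = y := by
  funext i
  simp [uncvec, cvec]

/-- Data noise of device `k` at `W`: local minus global gradient, vectorized. -/
def dataNoise {D d c K : ℕ} (e : Fin D × Fin d ≃ Fin c × Fin 2) (Fk : Fin K → Mat D d → ℝ)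
    (k : Fin K) (W : Mat D d) : Fin c → ℂ :=
  cvec e (gradient (Fk k) W) - cvec e (gradient (globalObj Fk) W)

/-- The data-noise covariance, averaged over the devices, is at most `κ² I` in the Loewner order.
(The average of the data noise itself is zero by the definition of the global objective.) -/
def DataNoiseBound {D d c K : ℕ} (e : Fin D × Fin d ≃ Fin c × Fin 2)
    (Fk : Fin K → Mat D d → ℝ) (κ : ℝ) : Prop :=
  ∀ W, ((((κ ^ 2 : ℝ) : ℂ) • (1 : Matrix (Fin c) (Fin c) ℂ)) - ((1 / (K : ℝ) : ℝ) : ℂ) •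
    ∑ k, Matrix.vecMulVec (dataNoise e Fk k W) (star (dataNoise e Fk k W))).PosSemidef

/-! ### The wireless channel -/

/-- The circularly symmetric complex Gaussian law `CN(0, v)`. -/
def complexGaussian (v : ℝ) : Measure ℂ :=
  ((gaussianReal 0 (v / 2).toNNReal).prod (gaussianReal 0 (v / 2).toNNReal)).map
    (fun p : ℝ × ℝ => (⟨p.1, p.2⟩ : ℂ))

/-- The activation probability `ζ = Pr(|h|² ≥ G)` for `h ∼ CN(0,1)`. -/
def actProb (G : ℝ) : ℝ := (complexGaussian 1).real {x : ℂ | G ≤ ‖x‖ ^ 2}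

/-- The joint law of the gains of the `K` devices on one sub-channel in one round: independent
`CN(0,1)` variables, conditioned on at least one device not being truncated. -/
def gainLaw (K : ℕ) (G : ℝ) : Measure (Fin K → ℂ) :=
  ProbabilityTheory.cond (Measure.pi (fun _ : Fin K => complexGaussian 1))
    {x : Fin K → ℂ | ∃ k, G ≤ ‖x k‖ ^ 2}

/-- The channel: `h n ω s k` is the gain of device `k` on sub-channel `s` in round `n`, and
`z n ω i` is the receiver noise on symbol `i` in round `n`. -/
structure IsChannel {Ω : Type*} [MeasurableSpace Ω] (P : Measure Ω) {K M c : ℕ} (G σ : ℝ)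
    (h : ℕ → Ω → Fin M → Fin K → ℂ) (z : ℕ → Ω → Fin c → ℂ) : Prop where
  measurable_gain : ∀ n, Measurable (h n)
  measurable_noise : ∀ n, Measurable (z n)
  law : ∀ n, P.map (fun ω => (h n ω, z n ω)) =
    (Measure.pi (fun _ : Fin M => gainLaw K G)).prod
      (Measure.pi (fun _ : Fin c => complexGaussian (σ ^ 2)))
  indep : iIndepFun (fun n ω => (h n ω, z n ω)) P

/-- Everything that the channel has revealed before round `n`. -/
@[reducible] def past {Ω : Type*} {K M c : ℕ} (h : ℕ → Ω → Fin M → Fin K → ℂ) (z : ℕ → Ω → Fin c → ℂ)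
    (n : ℕ) : MeasurableSpace Ω :=
  ⨆ j : Fin n, MeasurableSpace.comap (fun ω => (h j ω, z j ω)) inferInstance

/-- A power-control sequence: the receive power of round `n` lies in `[Pmin, Pmax]` and depends
only on the past of the channel. -/
structure IsPowerControl {Ω : Type*} {K M c : ℕ} (Pmin Pmax : ℝ)
    (h : ℕ → Ω → Fin M → Fin K → ℂ) (z : ℕ → Ω → Fin c → ℂ) (Prx : ℕ → Ω → ℝ) : Prop where
  adapted : ∀ n, Measurable[past h z n] (Prx n)
  mem_Icc : ∀ n ω, Prx n ω ∈ Set.Icc Pmin Pmax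

/-! ### One round of over-the-air aggregation -/

/-- Truncated channel inversion with receive power `p` at a gain `x`. -/
def precoder (G p : ℝ) (x : ℂ) : ℂ :=
  if G ≤ ‖x‖ ^ 2 then ((√p : ℝ) : ℂ) / x else 0

/-- The number of active devices at gains `x`. -/
def numActive {K : ℕ} (G : ℝ) (x : Fin K → ℂ) : ℕ := Nat.card {k : Fin K // G ≤ ‖x k‖ ^ 2}

/-- The noisy global gradient at `W` that the server recovers in a round with receive power `p`,
gains `h` and receiver noise `z`. Symbol `i` is sent over sub-channel `sub i`. Device `k` transmits
the normalized symbol `(g_k(W)_i - η) / ν`; the server de-normalizes what it receives. -/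
def receivedGradient {D d c K M : ℕ} (e : Fin D × Fin d ≃ Fin c × Fin 2) (sub : Fin c → Fin M)
    (G : ℝ) (η : ℂ) (ν : ℝ) (Fk : Fin K → Mat D d → ℝ) (W : Mat D d) (p : ℝ)
    (h : Fin M → Fin K → ℂ) (z : Fin c → ℂ) : Fin c → ℂ :=
  fun i =>
    (1 / (numActive G (h (sub i)) : ℂ)) * ((ν / √p : ℝ) : ℂ) *
      ((∑ k, h (sub i) k * precoder G p (h (sub i) k) *
        ((cvec e (gradient (Fk k) W) i - η) / (ν : ℂ))) + z i) + η

/-- The descent path of AirPCA with step size `μ` from `W₀`. -/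
def path {Ω : Type*} {D d c K M : ℕ} (e : Fin D × Fin d ≃ Fin c × Fin 2) (sub : Fin c → Fin M)
    (G : ℝ) (η : ℂ) (ν : ℝ) (Fk : Fin K → Mat D d → ℝ) (μ : ℝ)
    (h : ℕ → Ω → Fin M → Fin K → ℂ) (z : ℕ → Ω → Fin c → ℂ) (Prx : ℕ → Ω → ℝ)
    (W₀ : Mat D d) : ℕ → Ω → Mat D d
  | 0, _ => W₀
  | n + 1, ω =>
    path e sub G η ν Fk μ h z Prx W₀ n ω -
      μ • uncvec e (receivedGradient e sub G η ν Fk (path e sub G η ν Fk μ h z Prx W₀ n ω)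
        (Prx n ω) (h n ω) (z n ω))

/-- The event that the path `W` visits `R` at some round `n` with `0 ≤ n ≤ N - 1`, where the number
of rounds `N` may be any real number. -/
def entersWithin {Ω : Type*} {D d : ℕ} (W : ℕ → Ω → Mat D d) (R : Set (Mat D d)) (N : ℝ) :
    Set Ω :=
  {ω | ∃ n : ℕ, (n : ℝ) ≤ N - 1 ∧ W n ω ∈ R}

/-! ### The constants -/

def Vmax (K : ℕ) (G κ ν σ Pmin : ℝ) : ℝ :=
  κ ^ 2 / (K * actProb G) + 3 * ν ^ 2 * σ ^ 2 / ((K : ℝ) ^ 2 * actProb G ^ 2 * Pmin)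

def Vmin (K : ℕ) (ν σ Pmax : ℝ) : ℝ := ν ^ 2 * σ ^ 2 / ((K : ℝ) ^ 2 * Pmax)

/-- `N_max`, as a function of `μ`, `γ`, `c` and `V_max`, `V_min`. -/
def Nmax (μ γ : ℝ) (c : ℕ) (vmax vmin : ℝ) : ℝ :=
  1 / (2 * μ * γ) * Real.log (6 * c * (vmax / vmin) + 1)

/-- The constant `ρ`. -/
def rho (β γ : ℝ) (c : ℕ) (vmax vmin : ℝ) : ℝ :=
  min (2 * β * c / γ * Real.log (6 * c * (vmax / vmin) + 1)) 1

end AirPCA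

end

/-! Outside the optimum region the strict-saddle property makes every point improvable: the gradient
is large, or the Hessian has an eigenvalue at most `-γ` (`IsStrictSaddle.isImprovable`). The core is
`exists_window`: for any rate `A` fixed in advance there are `τ` and `μ₀` such that, for `μ ≤ μ₀`, a
window of about `τ / μ` rounds started within `μ` of an improvable point lowers the expected
objective by at least `A * τ * μ`. Since `A` is free, it can be tuned to give the constant 12 of the
theorem.

The window estimate is an improve-or-localize argument, carried out on expectations in
`exists_window_of_recursions`. If the objective fails to drop, the squared gradients along the
window have a sum of order `τ`. Then the mean squared displacement and the squared gradient at the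
starting point are of order `μ * τ ^ 2`, which excludes a large gradient once `μ` is small. Near a
saddle, the receiver noise injects variance of order `μ ^ 2` per round along the unstable
eigenvector, and the curvature amplifies it to order `μ * exp (γ * τ / 2)`. For large `τ` this
exceeds the localization bound `μ * τ ^ 2`; the powers of `μ` match, so `τ` is chosen independently
of `μ`. Fourth moments of the displacement control the Taylor remainder.

The channel enters through `IsNoise` only. Active devices are exchangeable and data noise sums to
zero over the devices, so the gradient error is centred; Gaussian receiver noise bounds its variance
below in every direction; and one dominating function with finite fourth moment serves all iterates
and admissible powers (`isNoise_roundNoise`). Independence of each round from the past turns this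
into one-step inequalities for test functions, conditionally on any past event
(`isNoisyDescent_path`).

Finally, rounds are grouped into blocks of one window. A countable cover by small balls extends the
drop to any past event on which the iterate lies near the complement of the region
(`setIntegral_nonneg_of_cover`). As the objective is bounded, telescoping bounds the probability of
never leaving that neighbourhood at block ends by a multiple of the inverse number of blocks
(`measureReal_forall_mem_le`). -/

namespace AirPCA

/-! ### Smooth functions -/

section Smooth

variable {E : Type*} [NormedAddCommGroup E]

/-- The mean value inequality on the ball of radius `‖y - x‖` loses the usual factor 1/2, which is
harmless here. Used for the objective and for its gradient. -/
theorem norm_sub_sub_fderiv_le [NormedSpace ℝ E] {G : Type*} [NormedAddCommGroup G]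
    [NormedSpace ℝ G] {f : E → G} {C : ℝ} (hf : Differentiable ℝ f)
    (hC : 0 ≤ C) (x : E) (hL : ∀ y, ‖fderiv ℝ f y - fderiv ℝ f x‖ ≤ C * ‖y - x‖) (y : E) :
    ‖f y - f x - fderiv ℝ f x (y - x)‖ ≤ C * ‖y - x‖ ^ 2 := by
  have h := (convex_closedBall x ‖y - x‖).norm_image_sub_le_of_norm_fderiv_le' (𝕜 := ℝ) (f := f)
    (φ := fderiv ℝ f x) (C := C * ‖y - x‖) (fun z _ => hf z)
    (fun z hz => (hL z).trans (by
      have : ‖z - x‖ ≤ ‖y - x‖ := by simpa [dist_eq_norm] using hz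
      gcongr))
    (Metric.mem_closedBall_self (norm_nonneg _)) (y := y) (by simp [dist_eq_norm])
  calc _ ≤ _ := h
    _ = _ := by ring

variable [InnerProductSpace ℝ E] [CompleteSpace E]

theorem le_add_inner_gradient {f : E → ℝ} {β : ℝ} (hf : Differentiable ℝ f) (hβ : 0 ≤ β)
    (hL : ∀ x y, ‖gradient f x - gradient f y‖ ≤ β * ‖x - y‖) (w v : E) :
    f (w + v) ≤ f w + inner ℝ (gradient f w) v + β * ‖v‖ ^ 2 := by
  have h := norm_sub_sub_fderiv_le hf hβ w (fun y => by
    rw [← toDual_gradient, ← toDual_gradient, ← map_sub, LinearIsometryEquiv.norm_map]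
    exact hL y w) (w + v)
  rw [add_sub_cancel_left, ← inner_gradient_left, Real.norm_eq_abs] at h
  linarith [(abs_le.1 h).2]

theorem norm_sub_inner_hessian_le {f : E → ℝ} {χ : ℝ} (hg : Differentiable ℝ (gradient f))
    (hχ : 0 ≤ χ)
    (hL : ∀ x y, ‖fderiv ℝ (gradient f) x - fderiv ℝ (gradient f) y‖ ≤ χ * ‖x - y‖) (x w : E) :
    ‖gradient f w - gradient f x - fderiv ℝ (gradient f) x (w - x)‖ ≤ χ * ‖w - x‖ ^ 2 :=
  norm_sub_sub_fderiv_le hg hχ x (fun y => hL y x) w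

theorem inner_fderiv_gradient_comm {f : E → ℝ} (hf : Differentiable ℝ f)
    (hg : Differentiable ℝ (gradient f)) (x u v : E) :
    inner ℝ (fderiv ℝ (gradient f) x u) v = inner ℝ u (fderiv ℝ (gradient f) x v) := by
  have h := second_derivative_symmetric (𝕜 := ℝ) (f := f) (f' := fun y => innerSL ℝ (gradient f y))
    (f'' := (innerSL ℝ).comp (fderiv ℝ (gradient f) x)) (x := x)
    (fun y => (hf y).hasGradientAt.hasFDerivAt)
    ((innerSL ℝ).hasFDerivAt.comp x (hg x).hasFDerivAt) u v
  simp only [ContinuousLinearMap.comp_apply, innerSL_apply_apply] at h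
  rw [h, real_inner_comm]

/-- The gradient along an eigenvector of the Hessian, up to a quadratic remainder. -/
theorem abs_inner_gradient_eigenvector_le {f : E → ℝ} {χ t : ℝ} (hf : Differentiable ℝ f)
    (hg : Differentiable ℝ (gradient f)) (hχ : 0 ≤ χ)
    (hL : ∀ x y, ‖fderiv ℝ (gradient f) x - fderiv ℝ (gradient f) y‖ ≤ χ * ‖x - y‖) {x v : E}
    (hv : ‖v‖ = 1) (ht : t ≠ 0) (hvt : fderiv ℝ (gradient f) x v = t • v) (w : E) :
    |inner ℝ v (gradient f w) - t * (inner ℝ v (w - x) + inner ℝ v (gradient f x) / t)| ≤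
      χ * ‖w - x‖ ^ 2 := by
  -- Symmetry moves the Hessian onto `v`, where it acts as `t`; the shift by `inner ℝ v (gradient f
  -- x) / t` absorbs the gradient at `x`, so only the Taylor remainder is left.
  have h1 : inner ℝ v (gradient f w) - t * (inner ℝ v (w - x) + inner ℝ v (gradient f x) / t) =
      inner ℝ v (gradient f w - gradient f x - fderiv ℝ (gradient f) x (w - x)) := by
    rw [inner_sub_right (y := gradient f w - gradient f x), inner_sub_right (y := gradient f w),
      ← inner_fderiv_gradient_comm hf hg, hvt, real_inner_smul_left, mul_add,
      mul_div_cancel₀ _ ht]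
    ring
  rw [h1]
  calc _ ≤ ‖v‖ * _ := abs_real_inner_le_norm _ _
    _ ≤ _ := by rw [hv, one_mul]; exact norm_sub_inner_hessian_le hg hχ hL x w

end Smooth

/-! ### One noisy gradient step -/

/-- A centred noise vector which is dominated by `D` and whose variance is at least `s` in every
direction. -/
structure IsNoise {U E : Type*} [MeasurableSpace U] [NormedAddCommGroup E] [InnerProductSpace ℝ E]
    (Λ : Measure U) (D : U → ℝ) (s : ℝ) (ξ : U → E) : Prop where
  aestronglyMeasurable : AEStronglyMeasurable ξ Λ
  norm_le : ∀ᵐ u ∂Λ, ‖ξ u‖ ≤ D u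
  integral_inner : ∀ v, ∫ u, inner ℝ v (ξ u) ∂Λ = 0
  le_integral_inner_sq : ∀ v, s * ‖v‖ ^ 2 ≤ ∫ u, inner ℝ v (ξ u) ^ 2 ∂Λ

section Step

variable {U E : Type*} [MeasurableSpace U] [NormedAddCommGroup E] [InnerProductSpace ℝ E]
  {Λ : Measure U} [IsProbabilityMeasure Λ] {D : U → ℝ} {s : ℝ} {ξ : U → E}

theorem integrable_pow_of_memLp_four {D : U → ℝ} (hD : MemLp D 4 Λ) {n : ℕ} (hn : n ≤ 4) :
    Integrable (fun u => |D u| ^ n) Λ := by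
  have h : MemLp D n Λ := hD.mono_exponent (by exact_mod_cast hn)
  simpa using h.integrable_norm_pow'

namespace IsNoise

theorem integrable_norm_pow (hξ : IsNoise Λ D s ξ) (hD : MemLp D 4 Λ) {n : ℕ} (hn : n ≤ 4) :
    Integrable (fun u => ‖ξ u‖ ^ n) Λ := by
  refine (integrable_pow_of_memLp_four hD hn).mono (hξ.aestronglyMeasurable.norm.pow n) ?_
  filter_upwards [hξ.norm_le] with u hu
  simp only [norm_pow, Real.norm_eq_abs, abs_abs, abs_norm]
  exact pow_le_pow_left₀ (norm_nonneg _) (hu.trans (le_abs_self _)) n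

theorem integral_norm_pow_le (hξ : IsNoise Λ D s ξ) (hD : MemLp D 4 Λ) {n : ℕ} (hn : n ≤ 4) :
    ∫ u, ‖ξ u‖ ^ n ∂Λ ≤ ∫ u, |D u| ^ n ∂Λ := by
  refine integral_mono_ae (hξ.integrable_norm_pow hD hn) (integrable_pow_of_memLp_four hD hn) ?_
  filter_upwards [hξ.norm_le] with u hu
  exact pow_le_pow_left₀ (norm_nonneg _) (hu.trans (le_abs_self _)) n

theorem integrable_inner (hξ : IsNoise Λ D s ξ) (hD : MemLp D 4 Λ) (v : E) :
    Integrable (fun u => inner ℝ v (ξ u)) Λ := by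
  have h := (hξ.integrable_norm_pow hD (n := 1) (by norm_num)).const_mul ‖v‖
  refine h.mono (aestronglyMeasurable_const.inner hξ.aestronglyMeasurable) ?_
  filter_upwards with u
  simpa using abs_real_inner_le_norm v (ξ u)

theorem integrable_inner_sq (hξ : IsNoise Λ D s ξ) (hD : MemLp D 4 Λ) (v : E) :
    Integrable (fun u => inner ℝ v (ξ u) ^ 2) Λ := by
  have h := (hξ.integrable_norm_pow hD (n := 2) (by norm_num)).const_mul (‖v‖ ^ 2)
  refine h.mono ((aestronglyMeasurable_const.inner hξ.aestronglyMeasurable).pow 2) ?_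
  filter_upwards with u
  have := pow_le_pow_left₀ (abs_nonneg _) (abs_real_inner_le_norm v (ξ u)) 2
  simpa [mul_pow] using this

/-- Integrating a polynomial bound in the noise. -/
theorem integral_le_of_le (hξ : IsNoise Λ D s ξ) (hD : MemLp D 4 Λ) {φ : U → ℝ} {a b e : ℝ} {v : E}
    (hb : 0 ≤ b) (he : 0 ≤ e) (h : ∀ u, φ u ≤ a + inner ℝ v (ξ u) + b * ‖ξ u‖ ^ 2 + e * ‖ξ u‖ ^ 4)
    (hφ : Integrable φ Λ) :
    ∫ u, φ u ∂Λ ≤ a + b * ∫ u, |D u| ^ 2 ∂Λ + e * ∫ u, |D u| ^ 4 ∂Λ := by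
  have i1 := hξ.integrable_inner hD v
  have i2 := (hξ.integrable_norm_pow hD (n := 2) (by norm_num)).const_mul b
  have i4 := (hξ.integrable_norm_pow hD (n := 4) (by norm_num)).const_mul e
  have i01 : Integrable (fun u => a + inner ℝ v (ξ u)) Λ := (integrable_const a).add i1
  have i02 : Integrable (fun u => a + inner ℝ v (ξ u) + b * ‖ξ u‖ ^ 2) Λ := i01.add i2
  calc ∫ u, φ u ∂Λ ≤ ∫ u, (a + inner ℝ v (ξ u) + b * ‖ξ u‖ ^ 2 + e * ‖ξ u‖ ^ 4) ∂Λ :=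
        integral_mono hφ (i02.add i4) h
    _ = a + b * ∫ u, ‖ξ u‖ ^ 2 ∂Λ + e * ∫ u, ‖ξ u‖ ^ 4 ∂Λ := by
        rw [integral_add i02 i4, integral_add i01 i2, integral_add (integrable_const a) i1,
          hξ.integral_inner, integral_const_mul, integral_const_mul]
        simp
    _ ≤ _ := by
        have h2 := hξ.integral_norm_pow_le hD (n := 2) (by norm_num)
        have h4 := hξ.integral_norm_pow_le hD (n := 4) (by norm_num)
        have := mul_le_mul_of_nonneg_left h2 hb
        have := mul_le_mul_of_nonneg_left h4 he
        linarith

end IsNoise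

/-! ### One-step moment inequalities -/

theorem norm_sub_smul_sq (a y : E) (μ : ℝ) :
    ‖a - μ • y‖ ^ 2 = ‖a‖ ^ 2 - 2 * μ * inner ℝ a y + μ ^ 2 * ‖y‖ ^ 2 := by
  rw [norm_sub_sq_real, norm_smul, real_inner_smul_right, mul_pow, Real.norm_eq_abs, sq_abs]
  ring

/-- The term linear in `y` is kept exact because it averages to zero for centred noise.
Cauchy–Schwarz and AM–GM treat the others: 8 = 2 + 4 + 2 and 3 = 1 + 2. -/
theorem norm_sub_smul_pow_four_le (a y : E) {μ : ℝ} (hμ : 0 ≤ μ) :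
    ‖a - μ • y‖ ^ 4 ≤ ‖a‖ ^ 4 - 4 * μ * ‖a‖ ^ 2 * inner ℝ a y + 8 * μ ^ 2 * ‖a‖ ^ 2 * ‖y‖ ^ 2 +
      3 * μ ^ 4 * ‖y‖ ^ 4 := by
  have h1 : ‖a - μ • y‖ ^ 4 = (‖a‖ ^ 2 - 2 * μ * inner ℝ a y + μ ^ 2 * ‖y‖ ^ 2) ^ 2 := by
    rw [← norm_sub_smul_sq]; ring
  have h2 := abs_real_inner_le_norm a y
  set i := inner ℝ a y
  set p := ‖a‖
  set n := ‖y‖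
  have hp : 0 ≤ p := norm_nonneg _
  have hn : 0 ≤ n := norm_nonneg _
  have h3 : i ^ 2 ≤ p ^ 2 * n ^ 2 := by
    rw [← mul_pow, ← sq_abs]; exact pow_le_pow_left₀ (abs_nonneg _) h2 2
  have h4 : -(p * n) ≤ i := (abs_le.1 h2).1
  rw [h1]
  have h5 : 0 ≤ 4 * μ ^ 2 * (p ^ 2 * n ^ 2 - i ^ 2) :=
    mul_nonneg (by positivity) (by linarith)
  have h6 : 0 ≤ 4 * μ ^ 3 * n ^ 2 * (i + p * n) := mul_nonneg (by positivity) (by linarith)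
  have h7 : 0 ≤ 2 * (μ * p * n - μ ^ 2 * n ^ 2) ^ 2 := by positivity
  nlinarith

/-- Expected descent of a smooth function in one step. -/
theorem integral_step_le [CompleteSpace E] [SecondCountableTopology E] [MeasurableSpace E]
    [BorelSpace E] {f : E → ℝ} {β μ B : ℝ}
    (hf : Differentiable ℝ f) (hβ : 0 ≤ β)
    (hL : ∀ x y, ‖gradient f x - gradient f y‖ ≤ β * ‖x - y‖) (hB : ∀ w, ‖f w‖ ≤ B)
    (hμ : 0 ≤ μ) (hμβ : μ * β ≤ 1 / 2) (hξ : IsNoise Λ D s ξ) (hD : MemLp D 4 Λ) (w : E) :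
    ∫ u, f (w - μ • (gradient f w + ξ u)) ∂Λ ≤
      f w - μ / 2 * ‖gradient f w‖ ^ 2 + β * (∫ u, |D u| ^ 2 ∂Λ) * μ ^ 2 := by
  have hm : AEStronglyMeasurable (fun u => f (w - μ • (gradient f w + ξ u))) Λ :=
    hf.continuous.comp_aestronglyMeasurable
      (aestronglyMeasurable_const.sub ((aestronglyMeasurable_const.add
        hξ.aestronglyMeasurable).const_smul μ))
  have hi : Integrable (fun u => f (w - μ • (gradient f w + ξ u))) Λ :=
    Integrable.of_bound hm B (Eventually.of_forall fun u => hB _)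
  set g := gradient f w with hg
  have := hξ.integral_le_of_le hD (φ := fun u => f (w - μ • (g + ξ u)))
    (a := f w - μ / 2 * ‖g‖ ^ 2) (b := β * μ ^ 2) (e := 0) (v := (-μ + 2 * β * μ ^ 2) • g)
    (by positivity) le_rfl (fun u => by
      have h1 := le_add_inner_gradient hf hβ hL w (-(μ • (g + ξ u)))
      rw [← sub_eq_add_neg, norm_neg, norm_smul, mul_pow, norm_add_sq_real, inner_neg_right,
        real_inner_smul_right, inner_add_right, ← hg, real_inner_self_eq_norm_sq,
        Real.norm_eq_abs, sq_abs] at h1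
      rw [real_inner_smul_left]
      have : 0 ≤ μ * (1 / 2 - μ * β) * ‖g‖ ^ 2 :=
        mul_nonneg (mul_nonneg hμ (by linarith)) (by positivity)
      nlinarith) hi
  linarith

theorem integrable_norm_sub_smul_pow (hξ : IsNoise Λ D s ξ) (hD : MemLp D 4 Λ) (a : E) (μ : ℝ)
    {n : ℕ} (hn : n ≤ 4) : Integrable (fun u => ‖a - μ • ξ u‖ ^ n) Λ := by
  have h4 : MemLp ξ 4 Λ := by
    refine hD.mono hξ.aestronglyMeasurable ?_
    filter_upwards [hξ.norm_le] with u hu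
    exact hu.trans (le_abs_self _)
  have h : MemLp (fun u => a - μ • ξ u) 4 Λ := (memLp_const a).sub (h4.const_smul μ)
  exact (h.mono_exponent (p := n) (by exact_mod_cast hn)).integrable_norm_pow'

theorem integral_norm_sub_smul_sq_le (hξ : IsNoise Λ D s ξ) (hD : MemLp D 4 Λ) (a : E) (μ : ℝ) :
    ∫ u, ‖a - μ • ξ u‖ ^ 2 ∂Λ ≤ ‖a‖ ^ 2 + μ ^ 2 * ∫ u, |D u| ^ 2 ∂Λ := by
  have := hξ.integral_le_of_le hD (φ := fun u => ‖a - μ • ξ u‖ ^ 2)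
    (a := ‖a‖ ^ 2) (b := μ ^ 2) (e := 0) (v := (-2 * μ) • a)
    (by positivity) le_rfl (fun u => by
      rw [norm_sub_smul_sq, real_inner_smul_left]; linarith)
    (integrable_norm_sub_smul_pow hξ hD a μ (by norm_num))
  linarith

theorem integral_norm_sub_smul_pow_four_le (hξ : IsNoise Λ D s ξ) (hD : MemLp D 4 Λ) (a : E)
    {μ : ℝ} (hμ : 0 ≤ μ) :
    ∫ u, ‖a - μ • ξ u‖ ^ 4 ∂Λ ≤ ‖a‖ ^ 4 + 8 * μ ^ 2 * ‖a‖ ^ 2 * (∫ u, |D u| ^ 2 ∂Λ) +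
      3 * μ ^ 4 * ∫ u, |D u| ^ 4 ∂Λ :=
  hξ.integral_le_of_le hD (φ := fun u => ‖a - μ • ξ u‖ ^ 4)
    (a := ‖a‖ ^ 4) (b := 8 * μ ^ 2 * ‖a‖ ^ 2) (e := 3 * μ ^ 4) (v := (-4 * μ * ‖a‖ ^ 2) • a)
    (by positivity) (by positivity) (fun u => by
      have := norm_sub_smul_pow_four_le a (ξ u) hμ
      rw [real_inner_smul_left]; linarith)
    (integrable_norm_sub_smul_pow hξ hD a μ (by norm_num))

/-- Growth of the second moment of the displacement in one step. -/
theorem integral_step_norm_sq_le (hξ : IsNoise Λ D s ξ) (hD : MemLp D 4 Λ) {μ τ : ℝ} (hμ : 0 < μ)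
    (hτ : μ ≤ τ) (x w g : E) :
    ∫ u, ‖w - μ • (g + ξ u) - x‖ ^ 2 ∂Λ ≤ (1 + μ / τ) * ‖w - x‖ ^ 2 + 2 * μ * τ * ‖g‖ ^ 2 +
      μ ^ 2 * ∫ u, |D u| ^ 2 ∂Λ := by
  have hτ0 : 0 < τ := hμ.trans_le hτ
  have h1 : ∀ u, w - μ • (g + ξ u) - x = (w - x - μ • g) - μ • ξ u := fun u => by
    rw [smul_add]; abel
  simp_rw [h1]
  refine (integral_norm_sub_smul_sq_le hξ hD _ μ).trans ?_
  gcongr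
  rw [norm_sub_smul_sq]
  -- Young's inequality with weight `τ`: the growth factor `1 + μ / τ` then stays bounded when
  -- compounded over at most `2 * τ / μ` rounds.
  have h2 : -(2 * inner ℝ (w - x) g) ≤ ‖w - x‖ ^ 2 / τ + τ * ‖g‖ ^ 2 := by
    have h3 := (abs_le.1 (abs_real_inner_le_norm (w - x) g)).1
    have h4 : 0 ≤ (‖w - x‖ - τ * ‖g‖) ^ 2 / τ := by positivity
    have h5 : (‖w - x‖ - τ * ‖g‖) ^ 2 / τ =
        ‖w - x‖ ^ 2 / τ + τ * ‖g‖ ^ 2 - 2 * (‖w - x‖ * ‖g‖) := by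
      field_simp
      ring
    linarith
  have h6 : μ * (-(2 * inner ℝ (w - x) g)) ≤ μ * (‖w - x‖ ^ 2 / τ + τ * ‖g‖ ^ 2) := by gcongr
  have h7 : μ ^ 2 * ‖g‖ ^ 2 ≤ μ * τ * ‖g‖ ^ 2 := by
    rw [sq μ]; gcongr
  have h8 : μ / τ * ‖w - x‖ ^ 2 = μ * (‖w - x‖ ^ 2 / τ) := by ring
  linarith

/-- Growth of the fourth moment of the displacement in one step. -/
theorem integral_step_norm_pow_four_le (hξ : IsNoise Λ D s ξ) (hD : MemLp D 4 Λ) {μ β g₀ : ℝ}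
    (hμ : 0 < μ) (hμ1 : μ ≤ 1) (hβ : 0 ≤ β) (hg₀ : 0 ≤ g₀) {x w g : E}
    (hg : ‖g‖ ≤ β * ‖w - x‖ + g₀) :
    ∫ u, ‖w - μ • (g + ξ u) - x‖ ^ 4 ∂Λ ≤ (1 + (40 * (1 + β) ^ 4 + 4) * μ) * ‖w - x‖ ^ 4 +
      40 * μ * g₀ ^ 4 +
      (4 * (∫ u, |D u| ^ 2 ∂Λ) ^ 2 + 3 * ∫ u, |D u| ^ 4 ∂Λ) * μ ^ 3 := by
  have h1 : ∀ u, w - μ • (g + ξ u) - x = (w - x - μ • g) - μ • ξ u := fun u => by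
    rw [smul_add]; abel
  simp_rw [h1]
  refine (integral_norm_sub_smul_pow_four_le hξ hD _ hμ.le).trans ?_
  have hV4 : 0 ≤ ∫ u, |D u| ^ 4 ∂Λ := integral_nonneg fun u => by positivity
  set V := ∫ u, |D u| ^ 2 ∂Λ
  set V4 := ∫ u, |D u| ^ 4 ∂Λ
  set n := ‖w - x‖ with hn
  have hn0 : 0 ≤ n := norm_nonneg _
  set p := ‖w - x - μ • g‖
  have hp0 : 0 ≤ p := norm_nonneg _
  -- Written as a convex combination with weight `μ`, so that convexity of the fourth power costs
  -- only a factor 1 + O(μ).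
  have hp : p ≤ (1 - μ) * n + μ * ((1 + β) * n + g₀) := by
    have : p ≤ n + ‖μ • g‖ := norm_sub_le _ _
    rw [norm_smul, Real.norm_eq_abs, abs_of_pos hμ] at this
    nlinarith
  have hconv : ∀ {a b t : ℝ}, 0 ≤ a → 0 ≤ b → 0 ≤ t → t ≤ 1 →
      ((1 - t) * a + t * b) ^ 4 ≤ (1 - t) * a ^ 4 + t * b ^ 4 := by
    intro a b t ha hb ht ht1
    exact (convexOn_pow 4).2 ha hb (sub_nonneg.2 ht1) ht (by ring)
  have hp4 : p ^ 4 ≤ (1 + 8 * (1 + β) ^ 4 * μ) * n ^ 4 + 8 * μ * g₀ ^ 4 := by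
    have e1 : p ^ 4 ≤ ((1 - μ) * n + μ * ((1 + β) * n + g₀)) ^ 4 := by gcongr
    have e2 := hconv hn0 (b := (1 + β) * n + g₀) (by positivity) hμ.le hμ1
    have e3 := hconv (a := 2 * ((1 + β) * n)) (b := 2 * g₀) (t := 1 / 2) (by positivity)
      (by positivity) (by norm_num) (by norm_num)
    have e4 : ((1 + β) * n + g₀) ^ 4 ≤ 8 * ((1 + β) ^ 4 * n ^ 4) + 8 * g₀ ^ 4 := by
      calc _ = ((1 - 1 / 2) * (2 * ((1 + β) * n)) + 1 / 2 * (2 * g₀)) ^ 4 := by ring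
        _ ≤ _ := e3
        _ = _ := by ring
    have e5 : (1 - μ) * n ^ 4 ≤ n ^ 4 := by
      have : 0 ≤ μ * n ^ 4 := by positivity
      linarith
    have e6 := mul_le_mul_of_nonneg_left e4 hμ.le
    linarith
  have h8 : 8 * μ ^ 2 * p ^ 2 * V ≤ 4 * μ * p ^ 4 + 4 * μ ^ 3 * V ^ 2 := by
    have : 0 ≤ 4 * μ * (p ^ 2 - μ * V) ^ 2 := by positivity
    nlinarith
  have h9 : 3 * μ ^ 4 * V4 ≤ 3 * μ ^ 3 * V4 := by
    have : μ ^ 4 ≤ μ ^ 3 := pow_le_pow_of_le_one hμ.le hμ1 (by norm_num)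
    gcongr
  have h10 : (1 + 4 * μ) * p ^ 4 ≤
      (1 + 4 * μ) * ((1 + 8 * (1 + β) ^ 4 * μ) * n ^ 4 + 8 * μ * g₀ ^ 4) := by gcongr
  have h11 : μ * μ * (8 * (1 + β) ^ 4 * n ^ 4 + 8 * g₀ ^ 4) ≤
      μ * 1 * (8 * (1 + β) ^ 4 * n ^ 4 + 8 * g₀ ^ 4) := by gcongr
  nlinarith

/-- Growth of the displacement along a direction of negative curvature in one step. -/
theorem le_integral_step_inner_sq (hξ : IsNoise Λ D s ξ) (hD : MemLp D 4 Λ) {μ γ t r b : ℝ}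
    (hμ : 0 < μ) (hγ : 0 < γ) (hμγ : μ * γ ≤ 1) (ht : t ≤ -γ) {x v w g : E} (hv : ‖v‖ = 1)
    (hg : |inner ℝ v g - t * (inner ℝ v (w - x) + b)| ≤ r) :
    (1 + μ * γ) * (inner ℝ v (w - x) + b) ^ 2 - 4 / γ * μ * r ^ 2 + μ ^ 2 * s ≤
      ∫ u, (inner ℝ v (w - μ • (g + ξ u) - x) + b) ^ 2 ∂Λ := by
  set y := inner ℝ v (w - x) + b with hy
  set ρ := inner ℝ v g - t * y with hρ
  set c := (1 - μ * t) * y - μ * ρ with hc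
  have h1 : ∀ u, (inner ℝ v (w - μ • (g + ξ u) - x) + b) ^ 2 =
      c ^ 2 - 2 * c * μ * inner ℝ v (ξ u) + μ ^ 2 * inner ℝ v (ξ u) ^ 2 := fun u => by
    have : w - μ • (g + ξ u) - x = (w - x) - μ • g - μ • ξ u := by rw [smul_add]; abel
    rw [this, inner_sub_right, inner_sub_right, real_inner_smul_right, real_inner_smul_right, hc,
      hρ, hy]
    ring
  simp_rw [h1]
  have i1 := (hξ.integrable_inner hD v).const_mul (2 * c * μ)
  have i2 := (hξ.integrable_inner_sq hD v).const_mul (μ ^ 2)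
  have i01 : Integrable (fun u => c ^ 2 - 2 * c * μ * inner ℝ v (ξ u)) Λ :=
    (integrable_const _).sub i1
  rw [integral_add i01 i2, integral_sub (integrable_const _) i1,
    integral_const_mul, integral_const_mul, hξ.integral_inner]
  have h2 := hξ.le_integral_inner_sq v
  rw [hv] at h2
  have h3 : μ ^ 2 * s ≤ μ ^ 2 * ∫ u, inner ℝ v (ξ u) ^ 2 ∂Λ := by
    gcongr; simpa using h2
  have hr : ρ ^ 2 ≤ r ^ 2 := by
    rw [← sq_abs]; exact pow_le_pow_left₀ (abs_nonneg _) hg 2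
  have h4 : (1 + μ * γ) * y ^ 2 - 4 / γ * μ * r ^ 2 ≤ c ^ 2 := by
    set k := 1 - μ * t
    have hk : 1 + μ * γ ≤ k := by
      have : μ * t ≤ μ * (-γ) := by gcongr
      simp only [k]; linarith
    -- The cross term with the remainder will cost the fraction `μ * γ / 4` of `k ^ 2 * y ^ 2`.
    -- Squaring doubles the linear growth, which leaves room for this loss as long as `μ * γ ≤ 1`.
    have hk2 : (1 + μ * γ) ≤ k ^ 2 * (1 - μ * γ / 4) := by
      have hz : 0 < μ * γ := by positivity
      have : (1 + μ * γ) ^ 2 * (1 - μ * γ / 4) ≤ k ^ 2 * (1 - μ * γ / 4) := by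
        gcongr
        linarith
      generalize μ * γ = z at *
      have : 0 ≤ z * (3 / 4 + z / 2 * (1 - z / 2)) :=
        mul_nonneg hz.le (add_nonneg (by norm_num) (mul_nonneg (by linarith) (by linarith)))
      linarith
    have e1 : 0 ≤ μ * γ / 4 * (k * y - 4 / γ * ρ) ^ 2 := by positivity
    have e2 : μ * γ / 4 * (k * y - 4 / γ * ρ) ^ 2 =
        μ * γ / 4 * k ^ 2 * y ^ 2 - 2 * μ * k * y * ρ + 4 / γ * μ * ρ ^ 2 := by
      field_simp
      ring
    have e3 : (1 + μ * γ) * y ^ 2 ≤ k ^ 2 * (1 - μ * γ / 4) * y ^ 2 := by gcongr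
    have e4 : 4 / γ * μ * ρ ^ 2 ≤ 4 / γ * μ * r ^ 2 := by gcongr
    have e5 : 0 ≤ μ ^ 2 * ρ ^ 2 := by positivity
    have e6 : c ^ 2 = k ^ 2 * y ^ 2 - 2 * μ * k * y * ρ + μ ^ 2 * ρ ^ 2 := by rw [hc]; ring
    nlinarith
  simp only [integral_const, probReal_univ, smul_eq_mul, one_mul, mul_zero, sub_zero]
  linarith

end Step

/-! ### Scalar recursions -/

theorem le_pow_mul_of_le_mul_add {u b : ℕ → ℝ} {a : ℝ} (ha : 1 ≤ a)
    (hb : ∀ j, 0 ≤ b j) (h : ∀ j, u (j + 1) ≤ a * u j + b j) (n : ℕ) :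
    u n ≤ a ^ n * (u 0 + ∑ j ∈ Finset.range n, b j) := by
  induction n with
  | zero => simp
  | succ n ih =>
    have hpow : 1 ≤ a ^ (n + 1) := one_le_pow₀ ha
    calc u (n + 1) ≤ a * u n + b n := h n
      _ ≤ a * (a ^ n * (u 0 + ∑ j ∈ Finset.range n, b j)) + a ^ (n + 1) * b n := by
        gcongr
        exact le_mul_of_one_le_left (hb n) hpow
      _ = _ := by rw [Finset.sum_range_succ]; ring

/-- The point `-r` is fixed by the affine recursion, so the distance to it grows geometrically even
from zero: constant forcing alone triggers the escape. -/
theorem mul_pow_sub_one_le_of_mul_add_le {y : ℕ → ℝ} {a r : ℝ} (ha : 0 ≤ a) (hy : 0 ≤ y 0)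
    {n : ℕ} (h : ∀ j < n, (1 + a) * y j + a * r ≤ y (j + 1)) :
    r * ((1 + a) ^ n - 1) ≤ y n := by
  induction n with
  | zero => simpa using hy
  | succ n ih =>
    have ih := ih fun j hj => h j (hj.trans n.lt_succ_self)
    have := mul_le_mul_of_nonneg_left ih (by linarith : 0 ≤ 1 + a)
    calc r * ((1 + a) ^ (n + 1) - 1) = (1 + a) * (r * ((1 + a) ^ n - 1)) + a * r := by ring
      _ ≤ (1 + a) * y n + a * r := by linarith
      _ ≤ y (n + 1) := h n n.lt_succ_self

theorem one_add_pow_le_exp {a b : ℝ} {n : ℕ} (ha : 0 ≤ a) (h : a * n ≤ b) :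
    (1 + a) ^ n ≤ Real.exp b := by
  calc (1 + a) ^ n ≤ Real.exp a ^ n := by
        gcongr; linarith [Real.add_one_le_exp a]
    _ = Real.exp (a * n) := by rw [← Real.exp_nat_mul, mul_comm]
    _ ≤ _ := Real.exp_le_exp.2 h

theorem exp_le_one_add_pow {a b : ℝ} {n : ℕ} (ha : 0 ≤ a) (ha1 : a ≤ 1) (h : b ≤ a * n) :
    Real.exp (b / 2) ≤ (1 + a) ^ n := by
  have h1 : Real.exp (a / 2) ≤ 1 + a := by
    have h2 : a / 2 ≤ 1 := by linarith
    have h3 := Real.abs_exp_sub_one_sub_id_le (x := a / 2) (by rw [abs_of_nonneg] <;> linarith)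
    have h4 := (abs_le.1 h3).2
    nlinarith
  calc Real.exp (b / 2) ≤ Real.exp (n * (a / 2)) := Real.exp_le_exp.2 (by linarith)
    _ = Real.exp (a / 2) ^ n := Real.exp_nat_mul _ _
    _ ≤ _ := by gcongr

/-- Selects the rescaled window length at which exponential escape beats quadratic localization. -/
theorem exists_sq_mul_lt_exp {a c : ℝ} (ha : 0 < a) :
    ∃ τ : ℝ, 1 ≤ τ ∧ 1 + c * τ ^ 2 < Real.exp (a * τ) := by
  have h1 : Tendsto (fun τ : ℝ => Real.exp (a * τ) / τ ^ 2) atTop atTop := by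
    have := tendsto_exp_mul_div_rpow_atTop 2 a ha
    refine this.congr fun τ => ?_
    norm_num
  obtain ⟨τ, hτ, hτ1⟩ := ((h1.eventually_gt_atTop (1 + |c|)).and (eventually_ge_atTop 1)).exists
  refine ⟨τ, hτ1, ?_⟩
  have h2 : 0 < τ ^ 2 := by positivity
  have h3 : 1 ≤ τ ^ 2 := one_le_pow₀ hτ1
  rw [lt_div_iff₀ h2] at hτ
  nlinarith [le_abs_self c]

set_option maxHeartbeats 1000000 in
/-- **Improve or localize.** Here `f`, `G`, `q`, `k`, `Y` are the expectations, along noisy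
gradient descent, of the objective, the squared gradient norm, the second and fourth powers of the
displacement and the square of its component along a direction of negative curvature. -/
theorem exists_window_of_recursions {A β γ χ ε V V₄ s c₄ : ℝ} (hA : 0 ≤ A) (hβ : 0 ≤ β)
    (hγ : 0 < γ) (hε : 0 < ε) (hV : 0 ≤ V) (hV₄ : 0 ≤ V₄) (hs : 0 < s) (hc₄ : 0 ≤ c₄) :
    ∃ τ : ℝ, 1 ≤ τ ∧ ∃ μ₀ : ℝ, 0 < μ₀ ∧ ∀ (μ : ℝ) (T : ℕ) (f G q k : ℕ → ℝ) (g : ℝ),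
      0 < μ → μ ≤ μ₀ → τ / μ ≤ T → T ≤ 2 * τ / μ → 0 ≤ g → (∀ j, 0 ≤ G j) →
      0 ≤ q 0 → q 0 ≤ μ ^ 2 → 0 ≤ k 0 → k 0 ≤ μ ^ 4 →
      (∀ j, f (j + 1) ≤ f j - μ / 2 * G j + β * V * μ ^ 2) →
      (∀ j, q (j + 1) ≤ (1 + μ / τ) * q j + 2 * μ * τ * G j + μ ^ 2 * V) →
      (∀ j, g ^ 2 ≤ 2 * G j + 2 * β ^ 2 * q j) →
      (∀ j, k (j + 1) ≤ (1 + c₄ * μ) * k j + 40 * μ * g ^ 4 + V₄ * μ ^ 3) →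
      (ε ≤ g ∨ ∃ Y : ℕ → ℝ, 0 ≤ Y 0 ∧ (∀ j, Y j ≤ 2 * q j + 2 * g ^ 2 / γ ^ 2) ∧
        ∀ j, (1 + μ * γ) * Y j - 4 / γ * μ * (χ ^ 2 * k j) + μ ^ 2 * s ≤ Y (j + 1)) →
      f T ≤ f 0 - A * τ * μ := by
  -- If the objective does not drop enough, `τ * a` bounds the sum of the squared gradients, `μ * τ
  -- ^ 2 * b` the mean squared displacement and `μ * τ ^ 2 * d` the squared gradient at the start.
  -- None of `a`, `b`, `d` involves `τ`, which can therefore be chosen after them.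
  set a := 2 * A + 4 * β * V with ha
  set b := Real.exp 2 * (1 + 2 * a + 2 * V) with hb
  set d := 2 * a + 2 * β ^ 2 * b with hd
  have ha0 : 0 ≤ a := by positivity
  have hb0 : 0 ≤ b := by positivity
  have hd0 : 0 ≤ d := by positivity
  obtain ⟨τ, hτ1, hτ⟩ := exists_sq_mul_lt_exp (a := γ / 2)
    (c := 2 * γ / s * (2 * b + 2 * d / γ ^ 2)) (by positivity)
  have hτ0 : 0 < τ := by linarith
  -- Fourth moments will be at most `κ * μ ^ 2`. The exponential dependence on `τ` is harmless,
  -- since `κ` affects only `μ₀`.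
  set κ := Real.exp (2 * c₄ * τ) * (1 + 2 * τ * (40 * (τ ^ 2 * d) ^ 2 + V₄)) with hκ
  have hκ0 : 0 ≤ κ := by positivity
  refine ⟨τ, hτ1, min (min 1 (1 / γ)) (min (ε ^ 2 / (2 * (τ ^ 2 * d + 1)))
    (s / (8 / γ * (χ ^ 2 * κ) + 1))), by positivity, ?_⟩
  intro μ T f G q k g hμ hμ₀ hT1 hT2 hg hG hq0 hq0' hk0 hk0' R1 R2 R3 R4 R5
  obtain ⟨⟨hμ1, hμγ⟩, hμε, hμs⟩ : (μ ≤ 1 ∧ μ ≤ 1 / γ) ∧ _ ∧ _ := by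
    simpa only [le_min_iff] using hμ₀
  rw [le_div_iff₀ hγ] at hμγ
  rw [le_div_iff₀ (by positivity)] at hμε hμs
  rw [div_le_iff₀ hμ] at hT1
  rw [le_div_iff₀ hμ] at hT2
  by_contra! hcon
  have hTpos : 0 < (T : ℝ) := by
    refine pos_of_mul_pos_left (b := μ) ?_ hμ.le
    linarith
  -- the gradients are small on average
  have hsum : ∑ j ∈ Finset.range T, G j ≤ τ * a := by
    have h1 : ∀ n : ℕ, f n ≤ f 0 - μ / 2 * ∑ j ∈ Finset.range n, G j + n * (β * V * μ ^ 2) := by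
      intro n
      induction n with
      | zero => simp
      | succ n ih =>
        rw [Finset.sum_range_succ]
        push_cast
        linarith [R1 n]
    have h2 := h1 T
    have h3 : (T * μ) * (β * V * μ) ≤ (2 * τ) * (β * V * μ) := by gcongr
    have h4 : μ * ∑ j ∈ Finset.range T, G j ≤ μ * (τ * a) := by
      rw [ha]; linarith
    exact le_of_mul_le_mul_left h4 hμ
  have hsum' : ∀ n ≤ T, ∑ j ∈ Finset.range n, G j ≤ τ * a := fun n hn =>
    (Finset.sum_le_sum_of_subset_of_nonneg (Finset.range_mono hn) fun j _ _ => hG j).trans hsum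
  have hnT : ∀ {n : ℕ}, n ≤ T → μ * n ≤ 2 * τ := fun {n} hn => by
    have h1 : (n : ℝ) ≤ T := by exact_mod_cast hn
    have h2 := mul_le_mul_of_nonneg_left h1 hμ.le
    linarith
  have hq : ∀ n ≤ T, q n ≤ μ * τ ^ 2 * b := by
    intro n hn
    have h1 := le_pow_mul_of_le_mul_add (u := q) (b := fun j => 2 * μ * τ * G j + μ ^ 2 * V)
      (a := 1 + μ / τ) (by have : 0 ≤ μ / τ := by positivity
                           linarith)
      (fun j => by have := hG j; positivity) (fun j => by linarith [R2 j]) n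
    have h2 : (1 + μ / τ) ^ n ≤ Real.exp 2 := by
      refine one_add_pow_le_exp (by positivity) ?_
      rw [div_mul_eq_mul_div, div_le_iff₀ hτ0]
      exact hnT hn
    have h3 : q 0 + ∑ j ∈ Finset.range n, (2 * μ * τ * G j + μ ^ 2 * V) ≤
        μ * τ ^ 2 * (1 + 2 * a + 2 * V) := by
      rw [Finset.sum_add_distrib, ← Finset.mul_sum]
      simp only [Finset.sum_const, Finset.card_range, nsmul_eq_mul]
      have e1 : 2 * μ * τ * ∑ j ∈ Finset.range n, G j ≤ 2 * μ * τ * (τ * a) := by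
        gcongr; exact hsum' n hn
      have e2 : (μ * n) * (μ * V) ≤ (2 * τ) * (μ * V) := by
        exact mul_le_mul_of_nonneg_right (hnT hn) (by positivity)
      have e3 : τ ≤ τ ^ 2 := le_self_pow₀ hτ1 (by norm_num)
      have e4 : τ * (2 * (μ * V)) ≤ τ ^ 2 * (2 * (μ * V)) := by gcongr
      have e5 : μ * μ ≤ μ * τ ^ 2 := by gcongr; exact hμ1.trans (one_le_pow₀ hτ1)
      linarith
    have h4 : 0 ≤ q 0 + ∑ j ∈ Finset.range n, (2 * μ * τ * G j + μ ^ 2 * V) :=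
      add_nonneg hq0 (Finset.sum_nonneg fun j _ => by have := hG j; positivity)
    calc q n ≤ _ := h1
      _ ≤ Real.exp 2 * (μ * τ ^ 2 * (1 + 2 * a + 2 * V)) := by gcongr
      _ = _ := by rw [hb]; ring
  -- Averaging over the window compares the fixed gradient at `x` with the gradients along the path;
  -- dividing the sum bound `τ * a` by `T ≥ τ / μ` produces the factor `μ`.
  have hg2 : g ^ 2 ≤ μ * τ ^ 2 * d := by
    have h1 : ∑ j ∈ Finset.range T, g ^ 2 ≤
        ∑ j ∈ Finset.range T, (2 * G j + 2 * β ^ 2 * (μ * τ ^ 2 * b)) := by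
      refine Finset.sum_le_sum fun j hj => (R3 j).trans ?_
      gcongr
      exact hq j (Finset.mem_range.1 hj).le
    rw [Finset.sum_add_distrib, ← Finset.mul_sum] at h1
    simp only [Finset.sum_const, Finset.card_range, nsmul_eq_mul] at h1
    have h2 : τ * a ≤ T * (μ * τ ^ 2 * a) := by
      calc τ * a ≤ (T * μ) * a := by gcongr
        _ ≤ (T * μ) * a * τ ^ 2 := le_mul_of_one_le_right (by positivity) (one_le_pow₀ hτ1)
        _ = _ := by ring
    have h3 : T * g ^ 2 ≤ T * (μ * τ ^ 2 * d) := by rw [hd]; linarith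
    exact le_of_mul_le_mul_left h3 hTpos
  rcases R5 with h5 | ⟨Y, hY0, R6, R5⟩
  · have : ε ^ 2 ≤ g ^ 2 := by gcongr
    have : 0 ≤ μ * τ ^ 2 * d := by positivity
    linarith
  have hk : ∀ n ≤ T, k n ≤ κ * μ ^ 2 := by
    intro n hn
    have h1 := le_pow_mul_of_le_mul_add (u := k) (b := fun j => 40 * μ * g ^ 4 + V₄ * μ ^ 3)
      (a := 1 + c₄ * μ) (by have : 0 ≤ c₄ * μ := by positivity
                            linarith)
      (fun j => by positivity) (fun j => by linarith [R4 j]) n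
    simp only [Finset.sum_const, Finset.card_range, nsmul_eq_mul] at h1
    have h2 : (1 + c₄ * μ) ^ n ≤ Real.exp (2 * c₄ * τ) := by
      refine one_add_pow_le_exp (by positivity) ?_
      have := mul_le_mul_of_nonneg_left (hnT hn) hc₄
      linarith
    have h3 : k 0 + n * (40 * μ * g ^ 4 + V₄ * μ ^ 3) ≤
        μ ^ 2 * (1 + 2 * τ * (40 * (τ ^ 2 * d) ^ 2 + V₄)) := by
      have e1 : g ^ 4 ≤ (μ * τ ^ 2 * d) ^ 2 := by
        calc g ^ 4 = (g ^ 2) ^ 2 := by ring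
          _ ≤ _ := by gcongr
      have e2 : n * (40 * μ * g ^ 4 + V₄ * μ ^ 3) ≤
          (μ * n) * (μ ^ 2 * (40 * (τ ^ 2 * d) ^ 2 + V₄)) := by
        calc n * (40 * μ * g ^ 4 + V₄ * μ ^ 3) ≤
            n * (40 * μ * (μ * τ ^ 2 * d) ^ 2 + V₄ * μ ^ 3) := by gcongr
          _ = _ := by ring
      have e3 : (μ * n) * (μ ^ 2 * (40 * (τ ^ 2 * d) ^ 2 + V₄)) ≤
          (2 * τ) * (μ ^ 2 * (40 * (τ ^ 2 * d) ^ 2 + V₄)) := by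
        exact mul_le_mul_of_nonneg_right (hnT hn) (by positivity)
      have e4 : μ ^ 4 ≤ μ ^ 2 := pow_le_pow_of_le_one hμ.le hμ1 (by norm_num)
      linarith
    have h4 : 0 ≤ k 0 + n * (40 * μ * g ^ 4 + V₄ * μ ^ 3) := by positivity
    calc k n ≤ _ := h1
      _ ≤ Real.exp (2 * c₄ * τ) * (μ ^ 2 * (1 + 2 * τ * (40 * (τ ^ 2 * d) ^ 2 + V₄))) := by
        gcongr
      _ = _ := by rw [hκ]; ring
  -- The Taylor remainder consumes at most half of the injected variance `μ ^ 2 * s`; the other half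
  -- equals `a * r`.
  have hYT := mul_pow_sub_one_le_of_mul_add_le (y := Y) (a := μ * γ) (r := μ * s / (2 * γ))
    (n := T) (by positivity) hY0 (fun j hj => by
      refine le_trans ?_ (R5 j)
      have e1 : 4 / γ * μ * (χ ^ 2 * k j) ≤ 4 / γ * μ * (χ ^ 2 * (κ * μ ^ 2)) := by
        gcongr; exact hk j hj.le
      have e2 : 4 / γ * μ * (χ ^ 2 * (κ * μ ^ 2)) ≤ μ ^ 2 * s / 2 := by
        have : μ * (8 / γ * (χ ^ 2 * κ)) ≤ s := by linarith
        have := mul_le_mul_of_nonneg_left this (by positivity : 0 ≤ μ ^ 2 / 2)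
        calc _ = μ ^ 2 / 2 * (μ * (8 / γ * (χ ^ 2 * κ))) := by ring
          _ ≤ _ := this
          _ = _ := by ring
      have e3 : μ * γ * (μ * s / (2 * γ)) = μ ^ 2 * s / 2 := by field_simp
      linarith)
  have hexp := exp_le_one_add_pow (a := μ * γ) (b := γ * τ) (n := T) (by positivity)
    (by linarith) (by have := mul_le_mul_of_nonneg_left hT1 hγ.le
                      linarith)
  -- The localization bound and the escape bound both carry exactly one factor `μ`, so the choice of
  -- `τ` alone yields the contradiction.
  have h1 : Y T ≤ μ * (τ ^ 2 * (2 * b + 2 * d / γ ^ 2)) := by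
    calc Y T ≤ 2 * q T + 2 * g ^ 2 / γ ^ 2 := R6 T
      _ ≤ 2 * (μ * τ ^ 2 * b) + 2 * (μ * τ ^ 2 * d) / γ ^ 2 := by gcongr; exact hq T le_rfl
      _ = _ := by ring
  have h2 : (2 * γ / s * (2 * b + 2 * d / γ ^ 2)) * τ ^ 2 < (1 + μ * γ) ^ T - 1 := by
    have : γ / 2 * τ = γ * τ / 2 := by ring
    rw [this] at hτ
    linarith
  have h3 : μ * s / (2 * γ) * ((2 * γ / s * (2 * b + 2 * d / γ ^ 2)) * τ ^ 2) <
      μ * s / (2 * γ) * ((1 + μ * γ) ^ T - 1) := by gcongr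
  have h4 : μ * s / (2 * γ) * ((2 * γ / s * (2 * b + 2 * d / γ ^ 2)) * τ ^ 2) =
      μ * (τ ^ 2 * (2 * b + 2 * d / γ ^ 2)) := by field_simp
  linarith

/-! ### Noisy gradient descent -/

/-- A process whose steps are noisy gradient steps, expressed through the one-step inequalities for
the expectation of test functions. -/
structure IsNoisyDescent {Ω U E : Type*} [MeasurableSpace Ω] [MeasurableSpace U]
    [NormedAddCommGroup E] [InnerProductSpace ℝ E] [CompleteSpace E] (Q : Measure Ω)
    (Λ : Measure U) (D : U → ℝ) (s : ℝ) (f : E → ℝ) (μ : ℝ) (W : ℕ → Ω → E) : Prop where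
  memLp : ∀ j, MemLp (W j) 4 Q
  transition : ∀ j (φ ψ : E → ℝ), Continuous φ →
    (∀ w ξ, IsNoise Λ D s ξ → ∫ u, φ (w - μ • (gradient f w + ξ u)) ∂Λ ≤ ψ w) →
    Integrable (fun ω => φ (W (j + 1) ω)) Q → Integrable (fun ω => ψ (W j ω)) Q →
    ∫ ω, φ (W (j + 1) ω) ∂Q ≤ ∫ ω, ψ (W j ω) ∂Q

/-- Points where the gradient is large or the Hessian has a very negative eigenvalue. -/
def IsImprovable {E : Type*} [NormedAddCommGroup E] [InnerProductSpace ℝ E] [CompleteSpace E]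
    (γ ε : ℝ) (f : E → ℝ) (x : E) : Prop :=
  ε ≤ ‖gradient f x‖ ∨ ∃ t ≤ -γ, ∃ v, ‖v‖ = 1 ∧ fderiv ℝ (gradient f) x v = t • v

set_option maxHeartbeats 400000 in
/-- Over a window of order `1 / μ` rounds that starts next to an improvable point, the expected
decrease of the objective is an arbitrarily large multiple of `μ` per unit of rescaled time. -/
theorem exists_window {U E : Type*} [MeasurableSpace U] [NormedAddCommGroup E]
    [InnerProductSpace ℝ E] [CompleteSpace E] [SecondCountableTopology E] [MeasurableSpace E]
    [BorelSpace E] (Λ : Measure U) (D : U → ℝ) {A β γ χ ε s : ℝ} (hA : 0 ≤ A) (hβ : 0 < β)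
    (hγ : 0 < γ) (hχ : 0 ≤ χ) (hε : 0 < ε) (hs : 0 < s) :
    ∃ τ : ℝ, 1 ≤ τ ∧ ∃ μ₀ : ℝ, 0 < μ₀ ∧ ∀ (μ : ℝ) (T : ℕ), 0 < μ → μ ≤ μ₀ → τ / μ ≤ T →
      T ≤ 2 * τ / μ → ∀ {Ω : Type*} [MeasurableSpace Ω] (Q : Measure Ω) [IsProbabilityMeasure Q]
      [IsProbabilityMeasure Λ] (_ : MemLp D 4 Λ)
      {f : E → ℝ} {B C : ℝ} (_ : Differentiable ℝ f) (_ : Differentiable ℝ (gradient f))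
      (_ : ∀ w, ‖f w‖ ≤ B) (_ : ∀ w, ‖gradient f w‖ ≤ C)
      (_ : ∀ x y, ‖gradient f x - gradient f y‖ ≤ β * ‖x - y‖)
      (_ : ∀ x y, ‖fderiv ℝ (gradient f) x - fderiv ℝ (gradient f) y‖ ≤ χ * ‖x - y‖)
      {W : ℕ → Ω → E} (_ : IsNoisyDescent Q Λ D s f μ W) {x : E} (_ : IsImprovable γ ε f x)
      (_ : ∀ᵐ ω ∂Q, ‖W 0 ω - x‖ ≤ μ),
      ∫ ω, f (W T ω) ∂Q ≤ ∫ ω, f (W 0 ω) ∂Q - A * τ * μ := by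
  have hV2 : 0 ≤ ∫ u, |D u| ^ 2 ∂Λ := integral_nonneg fun u => by positivity
  have hV4 : 0 ≤ ∫ u, |D u| ^ 4 ∂Λ := integral_nonneg fun u => by positivity
  set V := ∫ u, |D u| ^ 2 ∂Λ with hV
  set V₄ := ∫ u, |D u| ^ 4 ∂Λ with hV₄
  obtain ⟨τ, hτ, μ₀, hμ₀, H⟩ := exists_window_of_recursions (A := A) (β := β) (γ := γ) (χ := χ)
    (ε := ε) (V := V) (V₄ := 4 * V ^ 2 + 3 * V₄) (s := s) (c₄ := 40 * (1 + β) ^ 4 + 4) hA hβ.le hγ hε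
    hV2 (by positivity) hs (by positivity)
  refine ⟨τ, hτ, min μ₀ (min 1 (min (1 / (2 * β)) (1 / γ))), by positivity, ?_⟩
  intro μ T hμ hμle hT1 hT2 Ω _ Q _ _ hD f B C hf hg hB hC hL hH W hW x hx hx0
  obtain ⟨hμ1, hμ2, hμ3, hμ4⟩ : μ ≤ μ₀ ∧ μ ≤ 1 ∧ μ ≤ 1 / (2 * β) ∧ μ ≤ 1 / γ := by
    simpa only [le_min_iff] using hμle
  rw [le_div_iff₀ (by positivity)] at hμ3 hμ4
  have hδ : ∀ j, MemLp (fun ω => W j ω - x) 4 Q := fun j => (hW.memLp j).sub (memLp_const x)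
  have hδi : ∀ j {n : ℕ}, n ≤ 4 → Integrable (fun ω => ‖W j ω - x‖ ^ n) Q := fun j n hn =>
    ((hδ j).mono_exponent (p := n) (by exact_mod_cast hn)).integrable_norm_pow'
  have hfi : ∀ j, Integrable (fun ω => f (W j ω)) Q := fun j =>
    Integrable.of_bound (hf.continuous.comp_aestronglyMeasurable (hW.memLp j).1) B
      (Eventually.of_forall fun _ => hB _)
  have hGi : ∀ j, Integrable (fun ω => ‖gradient f (W j ω)‖ ^ 2) Q := fun j =>
    Integrable.of_bound
      ((hg.continuous.norm.pow 2).comp_aestronglyMeasurable (hW.memLp j).1) (C ^ 2)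
      (Eventually.of_forall fun _ => by
        rw [norm_pow, norm_norm]; exact pow_le_pow_left₀ (norm_nonneg _) (hC _) 2)
  have h0n : ∀ n : ℕ, ∫ ω, ‖W 0 ω - x‖ ^ n ∂Q ≤ μ ^ n := fun n => by
    have := integral_mono_of_nonneg (μ := Q) (f := fun ω => ‖W 0 ω - x‖ ^ n) (g := fun _ => μ ^ n)
      (Eventually.of_forall fun _ => by positivity) (integrable_const _) (by
        filter_upwards [hx0] with ω hω
        exact pow_le_pow_left₀ (norm_nonneg _) hω n)
    simpa using this
  have hgw : ∀ w, ‖gradient f w‖ ≤ β * ‖w - x‖ + ‖gradient f x‖ := fun w => by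
    calc _ = ‖(gradient f w - gradient f x) + gradient f x‖ := by rw [sub_add_cancel]
      _ ≤ _ := norm_add_le _ _
      _ ≤ _ := by gcongr; exact hL w x
  refine H μ T (fun j => ∫ ω, f (W j ω) ∂Q) (fun j => ∫ ω, ‖gradient f (W j ω)‖ ^ 2 ∂Q)
    (fun j => ∫ ω, ‖W j ω - x‖ ^ 2 ∂Q) (fun j => ∫ ω, ‖W j ω - x‖ ^ 4 ∂Q) ‖gradient f x‖
    hμ hμ1 hT1 hT2 (norm_nonneg _) (fun j => integral_nonneg fun _ => by positivity)
    (integral_nonneg fun _ => by positivity) (h0n 2) (integral_nonneg fun _ => by positivity)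
    (h0n 4) ?_ ?_ ?_ ?_ ?_
  · intro j
    have i1 : Integrable (fun ω => f (W j ω) - μ / 2 * ‖gradient f (W j ω)‖ ^ 2) Q :=
      (hfi j).sub ((hGi j).const_mul _)
    have := hW.transition j f (fun w => f w - μ / 2 * ‖gradient f w‖ ^ 2 + β * V * μ ^ 2)
      hf.continuous (fun w ξ hξ => integral_step_le hf hβ.le hL hB hμ.le (by linarith) hξ hD w)
      (hfi _) (i1.add (integrable_const _))
    rwa [integral_add i1 (integrable_const _), integral_sub (hfi j) ((hGi j).const_mul _),
      integral_const_mul, integral_const, probReal_univ, one_smul] at this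
  · intro j
    have i1 := (hδi j (n := 2) (by norm_num)).const_mul (1 + μ / τ)
    have i2 := (hGi j).const_mul (2 * μ * τ)
    have i3 : Integrable (fun ω => (1 + μ / τ) * ‖W j ω - x‖ ^ 2 +
      2 * μ * τ * ‖gradient f (W j ω)‖ ^ 2) Q := i1.add i2
    have := hW.transition j (fun w => ‖w - x‖ ^ 2) (fun w => (1 + μ / τ) * ‖w - x‖ ^ 2 +
      2 * μ * τ * ‖gradient f w‖ ^ 2 + μ ^ 2 * V) (by fun_prop)
      (fun w ξ hξ => integral_step_norm_sq_le hξ hD hμ (hμ2.trans hτ) x w _)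
      (hδi (j + 1) (n := 2) (by norm_num)) (i3.add (integrable_const _))
    rwa [integral_add i3 (integrable_const _), integral_add i1 i2,
      integral_const_mul, integral_const_mul, integral_const, probReal_univ, one_smul] at this
  · intro j
    have i1 := (hGi j).const_mul 2
    have i2 := (hδi j (n := 2) (by norm_num)).const_mul (2 * β ^ 2)
    have := integral_mono (μ := Q) (integrable_const (‖gradient f x‖ ^ 2)) (i1.add i2) (fun ω => by
      have h1 : ‖gradient f x‖ ≤ ‖gradient f (W j ω)‖ + β * ‖W j ω - x‖ := by
        have := norm_sub_norm_le (gradient f x) (gradient f (W j ω))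
        have h2 := hL x (W j ω)
        rw [norm_sub_rev x] at h2
        linarith
      have h2 := pow_le_pow_left₀ (norm_nonneg _) h1 2
      simp only [Pi.add_apply]
      linarith [sq_nonneg (‖gradient f (W j ω)‖ - β * ‖W j ω - x‖)])
    rwa [integral_add' i1 i2, integral_const_mul, integral_const_mul, integral_const,
      probReal_univ, one_smul] at this
  · intro j
    have hstep : ∀ w ξ, IsNoise Λ D s ξ →
        ∫ u, ‖w - μ • (gradient f w + ξ u) - x‖ ^ 4 ∂Λ ≤ (1 + (40 * (1 + β) ^ 4 + 4) * μ) *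
          ‖w - x‖ ^ 4 + 40 * μ * ‖gradient f x‖ ^ 4 + (4 * V ^ 2 + 3 * V₄) * μ ^ 3 :=
      fun w ξ hξ => integral_step_norm_pow_four_le hξ hD hμ hμ2 hβ.le (norm_nonneg _) (hgw w)
    generalize 1 + (40 * (1 + β) ^ 4 + 4) * μ = c at hstep ⊢
    generalize 40 * μ * ‖gradient f x‖ ^ 4 = c' at hstep ⊢
    generalize (4 * V ^ 2 + 3 * V₄) * μ ^ 3 = c'' at hstep ⊢
    have i1 := (hδi j (n := 4) (by norm_num)).const_mul c
    have i3 : Integrable (fun ω => c * ‖W j ω - x‖ ^ 4 + c') Q := i1.add (integrable_const _)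
    have := hW.transition j (fun w => ‖w - x‖ ^ 4) (fun w => c * ‖w - x‖ ^ 4 + c' + c'')
      (by fun_prop) hstep (hδi (j + 1) (n := 4) (by norm_num)) (i3.add (integrable_const _))
    rwa [integral_add i3 (integrable_const _), integral_add i1 (integrable_const _),
      integral_const_mul, integral_const, integral_const, probReal_univ, one_smul, one_smul] at this
  · refine hx.imp id ?_
    rintro ⟨t, ht, v, hv, hvt⟩
    have ht0 : t ≠ 0 := by linarith
    set b := inner ℝ v (gradient f x) / t with hb
    have hy : ∀ j, Integrable (fun ω => (inner ℝ v (W j ω - x) + b) ^ 2) Q := fun j => by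
      have h0 : MemLp (fun ω => inner ℝ v (W j ω - x)) 4 Q := (hδ j).const_inner v
      have h2 : MemLp (fun ω => inner ℝ v (W j ω - x)) 2 Q := h0.mono_exponent (by norm_num)
      have h1 : MemLp (fun ω => inner ℝ v (W j ω - x) + b) 2 Q := h2.add (memLp_const b)
      exact h1.integrable_sq
    refine ⟨fun j => ∫ ω, (inner ℝ v (W j ω - x) + b) ^ 2 ∂Q,
      integral_nonneg fun _ => by positivity, fun j => ?_, fun j => ?_⟩
    · have i1 := (hδi j (n := 2) (by norm_num)).const_mul 2
      have hb2 : b ^ 2 ≤ ‖gradient f x‖ ^ 2 / γ ^ 2 := by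
        rw [hb, div_pow]
        have h1 : inner ℝ v (gradient f x) ^ 2 ≤ ‖gradient f x‖ ^ 2 := by
          have := abs_real_inner_le_norm v (gradient f x)
          rw [hv, one_mul] at this
          rw [← sq_abs]
          exact pow_le_pow_left₀ (abs_nonneg _) this 2
        have h2 : γ ^ 2 ≤ t ^ 2 := by nlinarith
        gcongr
      have := integral_mono (μ := Q) (hy j)
        (i1.add (integrable_const (2 * ‖gradient f x‖ ^ 2 / γ ^ 2))) (fun ω => by
        have h1 : inner ℝ v (W j ω - x) ^ 2 ≤ ‖W j ω - x‖ ^ 2 := by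
          have := abs_real_inner_le_norm v (W j ω - x)
          rw [hv, one_mul] at this
          rw [← sq_abs]
          exact pow_le_pow_left₀ (abs_nonneg _) this 2
        simp only [Pi.add_apply]
        have h2 := sq_nonneg (inner ℝ v (W j ω - x) - b)
        rw [mul_div_assoc]
        linarith)
      rwa [integral_add' i1 (integrable_const _), integral_const_mul, integral_const,
        probReal_univ, one_smul] at this
    · have i1 := (hy j).const_mul (1 + μ * γ)
      have i2 := ((hδi j (n := 4) (by norm_num)).const_mul (χ ^ 2)).const_mul (4 / γ * μ)
      have i3 : Integrable (fun ω => (1 + μ * γ) * (inner ℝ v (W j ω - x) + b) ^ 2 -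
        4 / γ * μ * (χ ^ 2 * ‖W j ω - x‖ ^ 4)) Q := i1.sub i2
      have i4 : Integrable (fun ω => (1 + μ * γ) * (inner ℝ v (W j ω - x) + b) ^ 2 -
        4 / γ * μ * (χ ^ 2 * ‖W j ω - x‖ ^ 4) + μ ^ 2 * s) Q := i3.add (integrable_const _)
      -- Transitions provide upper bounds only, so the growth of the unstable component is obtained
      -- from the negated square.
      have := hW.transition j (fun w => -(inner ℝ v (w - x) + b) ^ 2)
        (fun w => -((1 + μ * γ) * (inner ℝ v (w - x) + b) ^ 2 -
          4 / γ * μ * (χ ^ 2 * ‖w - x‖ ^ 4) + μ ^ 2 * s)) (by fun_prop)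
        (fun w ξ hξ => by
          have h1 := le_integral_step_inner_sq hξ hD hμ hγ (by linarith) ht (b := b) (x := x)
            (w := w) (g := gradient f w) (r := χ * ‖w - x‖ ^ 2) hv
            (abs_inner_gradient_eigenvector_le hf hg hχ hH hv ht0 hvt w)
          rw [integral_neg]
          have h2 : (χ * ‖w - x‖ ^ 2) ^ 2 = χ ^ 2 * ‖w - x‖ ^ 4 := by ring
          rw [h2] at h1
          linarith)
        (hy _).neg i4.neg
      rw [integral_neg, integral_neg, neg_le_neg_iff, integral_add i3 (integrable_const _),
        integral_sub i1 i2, integral_const_mul, integral_const_mul, integral_const_mul,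
        integral_const, probReal_univ, one_smul] at this
      exact this

/-! ### Complex Gaussian variables -/

section Gaussian

theorem measurable_complex_mk : Measurable (fun p : ℝ × ℝ => (⟨p.1, p.2⟩ : ℂ)) :=
  Complex.measurableEquivRealProd.symm.measurable

instance isProbabilityMeasure_complexGaussian (v : ℝ) :
    IsProbabilityMeasure (complexGaussian v) :=
  Measure.isProbabilityMeasure_map measurable_complex_mk.aemeasurable

theorem memLp_id_complexGaussian (v : ℝ) {p : ENNReal} (hp : p ≠ ⊤) :
    MemLp id p (complexGaussian v) := by
  rw [complexGaussian, memLp_map_measure_iff aestronglyMeasurable_id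
    measurable_complex_mk.aemeasurable]
  have h := memLp_id_gaussianReal' (μ := 0) (v := (v / 2).toNNReal) p hp
  have h1 : MemLp (fun x : ℝ × ℝ => x.1) p ((gaussianReal 0 (v / 2).toNNReal).prod
      (gaussianReal 0 (v / 2).toNNReal)) := h.comp_measurePreserving measurePreserving_fst
  have h2 : MemLp (fun x : ℝ × ℝ => x.2) p ((gaussianReal 0 (v / 2).toNNReal).prod
      (gaussianReal 0 (v / 2).toNNReal)) := h.comp_measurePreserving measurePreserving_snd
  refine (h1.norm.add h2.norm).mono measurable_complex_mk.aestronglyMeasurable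
    (Eventually.of_forall fun x => ?_)
  simp only [Function.comp, id, Pi.add_apply, Real.norm_eq_abs]
  exact (Complex.norm_le_abs_re_add_abs_im _).trans (le_abs_self _)

theorem integral_linear_complexGaussian (v r t : ℝ) :
    ∫ x, (r * x.re + t * x.im) ∂(complexGaussian v) = 0 := by
  rw [complexGaussian, integral_map measurable_complex_mk.aemeasurable (by fun_prop)]
  have h := (memLp_id_gaussianReal' (μ := 0) (v := (v / 2).toNNReal) 1 (by simp)).integrable le_rfl
  have h1 : Integrable (fun x : ℝ × ℝ => r * x.1) ((gaussianReal 0 (v / 2).toNNReal).prod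
      (gaussianReal 0 (v / 2).toNNReal)) := (h.comp_fst _).const_mul r
  have h2 : Integrable (fun x : ℝ × ℝ => t * x.2) ((gaussianReal 0 (v / 2).toNNReal).prod
      (gaussianReal 0 (v / 2).toNNReal)) := (h.comp_snd _).const_mul t
  rw [integral_add h1 h2, integral_const_mul, integral_const_mul,
    integral_fun_fst (fun x : ℝ => x), integral_fun_snd (fun x : ℝ => x),
    integral_id_gaussianReal]
  simp

theorem variance_linear_complexGaussian {v : ℝ} (hv : 0 ≤ v) (r t : ℝ) :
    Var[fun x => r * x.re + t * x.im; complexGaussian v] = v / 2 * (r ^ 2 + t ^ 2) := by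
  rw [complexGaussian, variance_map (by fun_prop) measurable_complex_mk.aemeasurable]
  have h := memLp_id_gaussianReal' (μ := 0) (v := (v / 2).toNNReal) 2 (by simp)
  have hr : MemLp (fun x : ℝ => r * x) 2 (gaussianReal 0 (v / 2).toNNReal) := h.const_mul r
  have ht : MemLp (fun x : ℝ => t * x) 2 (gaussianReal 0 (v / 2).toNNReal) := h.const_mul t
  have h1 := variance_add_prod hr ht
  have h2 : ((fun x : ℂ => r * x.re + t * x.im) ∘ fun p : ℝ × ℝ => (⟨p.1, p.2⟩ : ℂ)) =
      fun p : ℝ × ℝ => r * p.1 + t * p.2 := rfl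
  rw [h2, h1, variance_const_mul, variance_const_mul, variance_fun_id_gaussianReal,
    Real.coe_toNNReal _ (by positivity)]
  ring

theorem memLp_linear_complexGaussian (v r t : ℝ) {p : ENNReal} (hp : p ≠ ⊤) :
    MemLp (fun x : ℂ => r * x.re + t * x.im) p (complexGaussian v) := by
  have h := memLp_id_complexGaussian v hp
  exact (h.re.const_mul r).add (h.im.const_mul t)

theorem ae_ne_zero_complexGaussian {v : ℝ} (hv : 0 < v) : ∀ᵐ x ∂(complexGaussian v), x ≠ 0 := by
  refine (ae_map_iff measurable_complex_mk.aemeasurable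
    (measurableSet_singleton (0 : ℂ)).compl).2 ?_
  have : NullSingletonClass (gaussianReal 0 (v / 2).toNNReal) := nullSingletonClass_gaussianReal (by
    simpa using hv)
  have h : ∀ᵐ x ∂(gaussianReal 0 (v / 2).toNNReal), x ≠ 0 := by
    simp [ae_iff]
  have h2 := (measurePreserving_fst (μ := gaussianReal 0 (v / 2).toNNReal)
    (ν := gaussianReal 0 (v / 2).toNNReal)).quasiMeasurePreserving.ae h
  filter_upwards [h2] with p hp h0
  exact hp (congrArg Complex.re h0)

/-- The half-plane of real part at least `√G` is contained in the event, and a nondegenerate real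
Gaussian charges every set of positive Lebesgue measure. -/
theorem actProb_pos (G : ℝ) : 0 < actProb G := by
  have hm : MeasurableSet {x : ℂ | G ≤ ‖x‖ ^ 2} := measurableSet_le measurable_const (by fun_prop)
  refine ENNReal.toReal_pos (fun h0 => ?_) (measure_ne_top _ _)
  rw [complexGaussian, Measure.map_apply measurable_complex_mk hm] at h0
  have h1 : Set.Ici √G ×ˢ Set.univ ⊆
      (fun p : ℝ × ℝ => (⟨p.1, p.2⟩ : ℂ)) ⁻¹' {x : ℂ | G ≤ ‖x‖ ^ 2} := by
    rintro ⟨a, b⟩ ⟨ha, -⟩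
    have h2 : G ≤ a ^ 2 := Real.sqrt_le_iff.1 ha |>.2
    simp only [Set.mem_preimage, Set.mem_ofPred_eq, Complex.sq_norm, Complex.normSq_mk]
    nlinarith [sq_nonneg b]
  have h3 := measure_mono_null h1 h0
  rw [Measure.prod_prod, measure_univ, mul_one] at h3
  have h4 := gaussianReal_absolutelyContinuous' 0 (v := (1 / 2 : ℝ).toNNReal) (by simp) h3
  simp at h4

variable {ι : Type*} [Fintype ι]

theorem memLp_linear_pi_complexGaussian (v : ℝ) (r t : ι → ℝ) {p : ENNReal} (hp : p ≠ ⊤) :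
    MemLp (fun z : ι → ℂ => ∑ i, (r i * (z i).re + t i * (z i).im)) p
      (Measure.pi fun _ => complexGaussian v) :=
  memLp_finsetSum _ fun i _ => (memLp_linear_complexGaussian v (r i) (t i) hp).comp_measurePreserving
    (measurePreserving_eval (fun _ : ι => complexGaussian v) i)

theorem integral_linear_pi_complexGaussian (v : ℝ) (r t : ι → ℝ) :
    ∫ z, ∑ i, (r i * (z i).re + t i * (z i).im) ∂(Measure.pi fun _ : ι => complexGaussian v) = 0 := by
  rw [integral_finsetSum]
  · refine Finset.sum_eq_zero fun i _ => ?_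
    have h := integral_comp_eval (μ := fun _ : ι => complexGaussian v) (i := i)
      (f := fun x : ℂ => r i * x.re + t i * x.im) (by fun_prop)
    rw [h, integral_linear_complexGaussian]
  · intro i _
    exact ((memLp_linear_complexGaussian v (r i) (t i) (p := 1) (by simp)).comp_measurePreserving
      (measurePreserving_eval (fun _ : ι => complexGaussian v) i)).integrable le_rfl

/-- Variances of independent coordinates add up, and a deterministic offset only increases the
second moment. In the application `a` is the data noise once the gains are fixed. -/
theorem le_integral_sq_linear_pi_complexGaussian {v : ℝ} (hv : 0 ≤ v) (a : ℝ) (r t : ι → ℝ) :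
    v / 2 * ∑ i, (r i ^ 2 + t i ^ 2) ≤
      ∫ z, (a + ∑ i, (r i * (z i).re + t i * (z i).im)) ^ 2
        ∂(Measure.pi fun _ : ι => complexGaussian v) := by
  set P := Measure.pi fun _ : ι => complexGaussian v
  set L : (ι → ℂ) → ℝ := fun z => ∑ i, (r i * (z i).re + t i * (z i).im) with hL
  have h2 : MemLp L 2 P := memLp_linear_pi_complexGaussian v r t (by simp)
  have h0 : ∫ z, L z ∂P = 0 := integral_linear_pi_complexGaussian v r t
  have hvar : ∫ z, L z ^ 2 ∂P = v / 2 * ∑ i, (r i ^ 2 + t i ^ 2) := by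
    rw [← variance_of_integral_eq_zero h2.1.aemeasurable h0]
    have h := variance_sum_pi (μ := fun _ : ι => complexGaussian v)
      (X := fun i (x : ℂ) => r i * x.re + t i * x.im)
      (fun i => memLp_linear_complexGaussian v (r i) (t i) (by simp))
    have h3 : (∑ i, fun z : ι → ℂ => r i * (z i).re + t i * (z i).im) = L := by
      ext z; simp [hL]
    rw [h3] at h
    rw [h, Finset.mul_sum]
    exact Finset.sum_congr rfl fun i _ => variance_linear_complexGaussian hv _ _
  have i1 : Integrable L P := h2.integrable (by norm_num)
  have i2 : Integrable (fun z => L z ^ 2) P := h2.integrable_sq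
  have i3 : Integrable (fun z => a ^ 2 + 2 * a * L z) P := (integrable_const _).add (i1.const_mul _)
  have h4 : ∀ z, (a + L z) ^ 2 = a ^ 2 + 2 * a * L z + L z ^ 2 := fun z => by ring
  change _ ≤ ∫ z, (a + L z) ^ 2 ∂P
  simp_rw [h4]
  rw [integral_add i3 i2, integral_add (integrable_const _) (i1.const_mul _), integral_const_mul,
    h0, hvar, integral_const, probReal_univ, one_smul]
  nlinarith [sq_nonneg a]

end Gaussian

/-! ### The gains of one sub-channel -/

section Gain

variable {K : ℕ} {G : ℝ}

theorem measurableSet_active (k : Fin K) : MeasurableSet {x : Fin K → ℂ | G ≤ ‖x k‖ ^ 2} :=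
  measurableSet_le measurable_const (by fun_prop)

theorem measurableSet_exists_active :
    MeasurableSet {x : Fin K → ℂ | ∃ k, G ≤ ‖x k‖ ^ 2} := by
  rw [Set.ofPred_exists]
  exact MeasurableSet.iUnion fun k => measurableSet_active k

theorem numActive_eq_sum (x : Fin K → ℂ) :
    numActive G x = ∑ k, if G ≤ ‖x k‖ ^ 2 then 1 else 0 := by
  classical
  rw [numActive, Nat.card_eq_fintype_card, Fintype.card_subtype, Finset.card_filter]

theorem measurable_numActive : Measurable (numActive G : (Fin K → ℂ) → ℕ) := by
  have : (numActive G : (Fin K → ℂ) → ℕ) = fun x => ∑ k, if G ≤ ‖x k‖ ^ 2 then 1 else 0 :=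
    funext numActive_eq_sum
  rw [this]
  exact Finset.measurable_sum _ fun k _ =>
    Measurable.ite (measurableSet_active k) measurable_const measurable_const

theorem numActive_le (x : Fin K → ℂ) : numActive G x ≤ K := by
  rw [numActive_eq_sum]
  calc _ ≤ ∑ _k : Fin K, 1 := Finset.sum_le_sum fun k _ => by split_ifs <;> simp
    _ = K := by simp

theorem numActive_pos {x : Fin K → ℂ} (hx : ∃ k, G ≤ ‖x k‖ ^ 2) : 0 < numActive G x := by
  obtain ⟨k, hk⟩ := hx
  rw [numActive_eq_sum]
  exact Finset.sum_pos' (fun _ _ => Nat.zero_le _) ⟨k, Finset.mem_univ _, by simp [hk]⟩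

/-- The weight of device `k` in the average over the active devices. -/
noncomputable def weight (G : ℝ) (k : Fin K) (x : Fin K → ℂ) : ℝ :=
  if G ≤ ‖x k‖ ^ 2 then 1 / (numActive G x : ℝ) else 0

theorem measurable_weight (k : Fin K) : Measurable (weight G k) :=
  Measurable.ite (measurableSet_active k)
    (measurable_const.div (measurable_from_nat.comp measurable_numActive)) measurable_const

theorem weight_nonneg (k : Fin K) (x : Fin K → ℂ) : 0 ≤ weight G k x := by
  unfold weight; split_ifs <;> positivity

theorem sum_weight {x : Fin K → ℂ} (hx : ∃ k, G ≤ ‖x k‖ ^ 2) : ∑ k, weight G k x = 1 := by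
  have h : (0 : ℝ) < numActive G x := by exact_mod_cast numActive_pos hx
  have h2 : (numActive G x : ℝ) = ∑ k, if G ≤ ‖x k‖ ^ 2 then 1 else 0 := by
    rw [numActive_eq_sum]; push_cast; rfl
  calc ∑ k, weight G k x = ∑ k, (if G ≤ ‖x k‖ ^ 2 then 1 else 0) * (1 / (numActive G x : ℝ)) :=
        Finset.sum_congr rfl fun k _ => by unfold weight; split_ifs <;> simp
    _ = 1 := by rw [← Finset.sum_mul, ← h2]; field_simp

theorem weight_le_one (k : Fin K) (x : Fin K → ℂ) : weight G k x ≤ 1 := by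
  unfold weight
  split_ifs with h
  · have : (1 : ℝ) ≤ numActive G x := by exact_mod_cast numActive_pos ⟨k, h⟩
    exact (div_le_one (by linarith)).2 this
  · norm_num

/-- Both the product of identical laws and the event conditioned on are invariant under permutations
of the devices. -/
theorem measurePreserving_gainLaw_comp (π : Equiv.Perm (Fin K)) :
    MeasurePreserving (fun x : Fin K → ℂ => x ∘ π) (gainLaw K G) (gainLaw K G) := by
  have h := measurePreserving_piCongrLeft (α := fun _ : Fin K => ℂ)
    (fun _ : Fin K => complexGaussian 1) π.symm
  have h2 : (MeasurableEquiv.piCongrLeft (fun _ : Fin K => ℂ) π.symm : (Fin K → ℂ) → _) =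
      fun x => x ∘ π := by
    ext x k
    have := MeasurableEquiv.piCongrLeft_apply_apply (β := fun _ : Fin K => ℂ) π.symm x (π k)
    simpa using this
  rw [h2] at h
  have hpre : (fun x : Fin K → ℂ => x ∘ π) ⁻¹' {x | ∃ k, G ≤ ‖x k‖ ^ 2} =
      {x | ∃ k, G ≤ ‖x k‖ ^ 2} := by
    ext x
    exact ⟨fun ⟨k, hk⟩ => ⟨π k, hk⟩, fun ⟨k, hk⟩ => ⟨π.symm k, by simpa using hk⟩⟩
  have h3 := h.restrict_preimage (measurableSet_exists_active (K := K) (G := G))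
  rw [hpre] at h3
  exact h3.smul_measure _

theorem weight_comp (π : Equiv.Perm (Fin K)) (k : Fin K) (x : Fin K → ℂ) :
    weight G k (x ∘ π) = weight G (π k) x := by
  have : numActive G (x ∘ π) = numActive G x := by
    rw [numActive_eq_sum, numActive_eq_sum]
    exact Equiv.sum_comp π fun k => if G ≤ ‖x k‖ ^ 2 then 1 else 0
  simp [weight, this]

/-- The active devices are exchangeable. -/
theorem integral_weight_eq (k l : Fin K) :
    ∫ x, weight G k x ∂(gainLaw K G) = ∫ x, weight G l x ∂(gainLaw K G) := by
  have h := measurePreserving_gainLaw_comp (G := G) (Equiv.swap k l)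
  calc ∫ x, weight G k x ∂(gainLaw K G)
      = ∫ x, weight G k x ∂((gainLaw K G).map fun x => x ∘ Equiv.swap k l) := by rw [h.map_eq]
    _ = ∫ x, weight G k (x ∘ Equiv.swap k l) ∂(gainLaw K G) :=
        integral_map h.measurable.aemeasurable (measurable_weight k).aestronglyMeasurable
    _ = _ := by simp_rw [weight_comp, Equiv.swap_apply_left]

theorem integrable_weight [IsFiniteMeasure (gainLaw K G)] (k : Fin K) :
    Integrable (weight G k) (gainLaw K G) :=
  Integrable.of_bound (measurable_weight k).aestronglyMeasurable 1
    (Eventually.of_forall fun x => by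
      rw [Real.norm_eq_abs, abs_of_nonneg (weight_nonneg k x)]; exact weight_le_one k x)

theorem ae_gainLaw : ∀ᵐ x ∂(gainLaw K G), (∃ k, G ≤ ‖x k‖ ^ 2) ∧ ∀ k, x k ≠ 0 := by
  refine (ae_cond_mem measurableSet_exists_active).and ?_
  rw [ae_all_iff]
  intro k
  refine cond_absolutelyContinuous.ae_le ?_
  exact (measurePreserving_eval (fun _ : Fin K => complexGaussian 1)
    k).quasiMeasurePreserving.ae (ae_ne_zero_complexGaussian one_pos)

/-- Conditioning on a null event yields the zero measure by convention, so nonvanishing is all that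
has to be checked. -/
theorem isProbabilityMeasure_gainLaw_of_ne_zero (h : gainLaw K G ≠ 0) :
    IsProbabilityMeasure (gainLaw K G) := by
  rw [gainLaw, Ne, cond_eq_zero, not_or] at h
  exact cond_isProbabilityMeasure h.2

end Gain

/-! ### The noise of one round -/

section Vectorization

variable {D d c : ℕ} (e : Fin D × Fin d ≃ Fin c × Fin 2)

theorem inner_uncvec (v : Mat D d) (y : Fin c → ℂ) :
    inner ℝ v (uncvec e y) =
      ∑ i, ((cvec e v i).re * (y i).re + (cvec e v i).im * (y i).im) := by
  rw [PiLp.inner_apply, ← e.symm.sum_comp, Fintype.sum_prod_type]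
  refine Finset.sum_congr rfl fun i _ => ?_
  simp [Fin.sum_univ_two, cvec, uncvec, mul_comm]

theorem norm_sq_eq_sum_cvec (v : Mat D d) :
    ‖v‖ ^ 2 = ∑ i, ((cvec e v i).re ^ 2 + (cvec e v i).im ^ 2) := by
  have h := inner_uncvec e v (cvec e v)
  rw [uncvec_cvec, real_inner_self_eq_norm_sq] at h
  rw [h]
  exact Finset.sum_congr rfl fun i _ => by ring

theorem norm_uncvec_le (y : Fin c → ℂ) : ‖uncvec e y‖ ≤ ∑ i, ‖y i‖ := by
  have h := norm_sq_eq_sum_cvec e (uncvec e y)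
  rw [cvec_uncvec] at h
  have h2 : ∑ i, ((y i).re ^ 2 + (y i).im ^ 2) = ∑ i, ‖y i‖ ^ 2 :=
    Finset.sum_congr rfl fun i _ => by rw [Complex.sq_norm, Complex.normSq_apply]; ring
  refine le_of_sq_le_sq ?_ (Finset.sum_nonneg fun i _ => norm_nonneg _)
  rw [h, h2]
  exact Finset.sum_sq_le_sq_sum_of_nonneg fun i _ => norm_nonneg _

theorem uncvec_sub (y y' : Fin c → ℂ) : uncvec e (y - y') = uncvec e y - uncvec e y' := by
  ext p
  simp only [uncvec, PiLp.sub_apply, Pi.sub_apply]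
  split_ifs <;> simp

theorem measurable_cvec : Measurable (cvec e : Mat D d → Fin c → ℂ) := by
  refine measurable_pi_lambda _ fun i => ?_
  exact measurable_complex_mk.comp (by fun_prop : Measurable fun A : Mat D d =>
    ((A (e.symm (i, 0)), A (e.symm (i, 1))) : ℝ × ℝ))

theorem measurable_uncvec : Measurable (uncvec e : (Fin c → ℂ) → Mat D d) := by
  refine (WithLp.measurable_toLp 2 _).comp (measurable_pi_lambda _ fun p => ?_)
  split_ifs <;> fun_prop

end Vectorization

section Round

variable {D d c K M : ℕ} {e : Fin D × Fin d ≃ Fin c × Fin 2} {Fk : Fin K → Mat D d → ℝ}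

theorem gradient_globalObj (hF : ∀ k, Differentiable ℝ (Fk k)) (W : Mat D d) :
    gradient (globalObj Fk) W = (1 / (K : ℝ)) • ∑ k, gradient (Fk k) W := by
  have h : HasFDerivAt (globalObj Fk) ((1 / (K : ℝ)) • ∑ k, fderiv ℝ (Fk k) W) W :=
    (HasFDerivAt.fun_sum fun k _ => (hF k W).hasFDerivAt).const_mul _
  simp only [gradient, h.fderiv, map_smul, map_sum]

theorem sum_dataNoise (hK : 0 < K) (hF : ∀ k, Differentiable ℝ (Fk k)) (W : Mat D d) (i : Fin c) :
    ∑ k, dataNoise e Fk k W i = 0 := by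
  have hK' : (K : ℝ) ≠ 0 := by exact_mod_cast hK.ne'
  simp only [dataNoise, Pi.sub_apply, Finset.sum_sub_distrib, Finset.sum_const, Finset.card_univ,
    Fintype.card_fin, cvec, gradient_globalObj hF]
  apply Complex.ext <;> simp <;> field_simp <;> simp

/-- A diagonal entry of the Loewner bound controls the mean over the devices; passing to a single
device costs the factor `K`. -/
theorem norm_dataNoise_sq_le (hK : 0 < K) {κ : ℝ} (h : DataNoiseBound e Fk κ) (k : Fin K)
    (W : Mat D d) (i : Fin c) : ‖dataNoise e Fk k W i‖ ^ 2 ≤ K * κ ^ 2 := by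
  have hK' : (0 : ℝ) < K := by exact_mod_cast hK
  have h1 := (h W).diag_nonneg (i := i)
  have h2 : ((((κ ^ 2 : ℝ) : ℂ) • (1 : Matrix (Fin c) (Fin c) ℂ)) - ((1 / (K : ℝ) : ℝ) : ℂ) •
      ∑ k, Matrix.vecMulVec (dataNoise e Fk k W) (star (dataNoise e Fk k W))) i i =
      ((κ ^ 2 - 1 / K * ∑ k, ‖dataNoise e Fk k W i‖ ^ 2 : ℝ) : ℂ) := by
    simp only [Matrix.sub_apply, Matrix.smul_apply, Matrix.one_apply_eq, Matrix.sum_apply,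
      Matrix.vecMulVec_apply, Pi.star_apply, smul_eq_mul, RCLike.star_def, Complex.mul_conj']
    push_cast
    ring
  rw [h2] at h1
  have h3 : (0 : ℝ) ≤ κ ^ 2 - 1 / K * ∑ k, ‖dataNoise e Fk k W i‖ ^ 2 := by exact_mod_cast h1
  have h4 : ‖dataNoise e Fk k W i‖ ^ 2 ≤ ∑ k, ‖dataNoise e Fk k W i‖ ^ 2 :=
    Finset.single_le_sum (f := fun k => ‖dataNoise e Fk k W i‖ ^ 2) (fun _ _ => by positivity)
      (Finset.mem_univ k)
  have h5 : K * (1 / K * ∑ k, ‖dataNoise e Fk k W i‖ ^ 2) = ∑ k, ‖dataNoise e Fk k W i‖ ^ 2 := by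
    field_simp
  nlinarith

theorem measurable_gradient (f : Mat D d → ℝ) : Measurable (gradient f) :=
  (InnerProductSpace.toDual ℝ (Mat D d)).symm.continuous.measurable.comp (measurable_fderiv ℝ f)

theorem measurable_receivedGradient (sub : Fin c → Fin M) (G : ℝ) (η : ℂ) (ν : ℝ) :
    Measurable fun x : (Mat D d × ℝ) × (Fin M → Fin K → ℂ) × (Fin c → ℂ) =>
      receivedGradient e sub G η ν Fk x.1.1 x.1.2 x.2.1 x.2.2 := by
  refine measurable_pi_lambda _ fun i => ?_
  unfold receivedGradient
  have h1 : Measurable fun x : (Mat D d × ℝ) × (Fin M → Fin K → ℂ) × (Fin c → ℂ) =>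
      (numActive G (x.2.1 (sub i)) : ℂ) :=
    (measurable_from_nat (f := fun n : ℕ => (n : ℂ))).comp (measurable_numActive.comp (by fun_prop))
  have h2 : Measurable fun x : (Mat D d × ℝ) × (Fin M → Fin K → ℂ) × (Fin c → ℂ) =>
      ((ν / √x.1.2 : ℝ) : ℂ) := by
    refine Complex.measurable_ofReal.comp (measurable_const.div ?_)
    exact Real.continuous_sqrt.measurable.comp (by fun_prop)
  have h3 : ∀ k, Measurable fun x : (Mat D d × ℝ) × (Fin M → Fin K → ℂ) × (Fin c → ℂ) =>
      cvec e (gradient (Fk k) x.1.1) i := fun k =>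
    (measurable_pi_apply i).comp ((measurable_cvec e).comp
      ((measurable_gradient (Fk k)).comp (by fun_prop)))
  have h4 : ∀ k, Measurable fun x : (Mat D d × ℝ) × (Fin M → Fin K → ℂ) × (Fin c → ℂ) =>
      precoder G x.1.2 (x.2.1 (sub i) k) := fun k => by
    unfold precoder
    refine Measurable.ite (measurableSet_le measurable_const (by fun_prop)) ?_ measurable_const
    refine Measurable.div (Complex.measurable_ofReal.comp ?_) (by fun_prop)
    exact Real.continuous_sqrt.measurable.comp (by fun_prop)
  refine ((((measurable_const.div h1).mul h2).mul ((Finset.measurable_fun_sum _ fun k _ => ?_).add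
    (by fun_prop))).add measurable_const)
  exact Measurable.mul (Measurable.mul (by fun_prop) (h4 k))
    (((h3 k).sub measurable_const).div measurable_const)

/-- Where some device is active and no gain vanishes, the received gradient is the global gradient
plus the averaged data noise of the active devices plus scaled receiver noise. -/
theorem receivedGradient_sub (sub : Fin c → Fin M) {G ν p : ℝ} (η : ℂ) (hν : 0 < ν) (hp : 0 < p)
    (W : Mat D d) {h : Fin M → Fin K → ℂ} (z : Fin c → ℂ) (i : Fin c)
    (hact : ∃ k, G ≤ ‖h (sub i) k‖ ^ 2) (hne : ∀ k, h (sub i) k ≠ 0) :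
    receivedGradient e sub G η ν Fk W p h z i - cvec e (gradient (globalObj Fk) W) i =
      ∑ k, (weight G k (h (sub i)) : ℂ) * dataNoise e Fk k W i +
        ((ν / (numActive G (h (sub i)) * √p) : ℝ) : ℂ) * z i := by
  set x := h (sub i) with hx
  have hX : (numActive G x : ℂ) ≠ 0 := by exact_mod_cast (numActive_pos hact).ne'
  have hp' : ((√p : ℝ) : ℂ) ≠ 0 := by exact_mod_cast (Real.sqrt_pos.2 hp).ne'
  have hν' : (ν : ℂ) ≠ 0 := by exact_mod_cast hν.ne'
  have h1 : ∑ k, (weight G k x : ℂ) = 1 := by exact_mod_cast sum_weight hact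
  set g := cvec e (gradient (globalObj Fk) W) i
  have h2 : ∀ k, 1 / (numActive G x : ℂ) * ((ν / √p : ℝ) : ℂ) *
      (x k * precoder G p (x k) * ((cvec e (gradient (Fk k) W) i - η) / ν)) =
      (weight G k x : ℂ) * dataNoise e Fk k W i + (weight G k x : ℂ) * (g - η) := fun k => by
    have h3 : dataNoise e Fk k W i = cvec e (gradient (Fk k) W) i - g := rfl
    rw [h3, ← mul_add]
    unfold weight precoder
    have := hne k
    split_ifs
    · push_cast
      field_simp
      ring
    · simp
  simp only [receivedGradient, ← hx]
  rw [mul_add, Finset.mul_sum, Finset.sum_congr rfl fun k _ => h2 k, Finset.sum_add_distrib,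
    ← Finset.sum_mul, h1]
  push_cast
  field_simp
  ring

/-- The joint law of gains and receiver noise in one round. -/
noncomputable def roundLaw (K M c : ℕ) (G σ : ℝ) :
    Measure ((Fin M → Fin K → ℂ) × (Fin c → ℂ)) :=
  (Measure.pi fun _ : Fin M => gainLaw K G).prod
    (Measure.pi fun _ : Fin c => complexGaussian (σ ^ 2))

/-- A bound for the norm of the noise of one round. -/
noncomputable def noiseBound (M : ℕ) {K c : ℕ} (κ ν Pmin : ℝ)
    (u : (Fin M → Fin K → ℂ) × (Fin c → ℂ)) : ℝ :=
  ∑ i, (√(K * κ ^ 2) + ν / √Pmin * ‖u.2 i‖)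

theorem memLp_noiseBound {G : ℝ} [IsProbabilityMeasure (gainLaw K G)] (σ κ ν Pmin : ℝ) :
    MemLp (noiseBound M κ ν Pmin) 4 (roundLaw K M c G σ) := by
  have h1 : MemLp (fun x : ℂ => ‖x‖) 4 (complexGaussian (σ ^ 2)) :=
    (memLp_id_complexGaussian (σ ^ 2) (by simp)).norm
  have h2 : ∀ i, MemLp (fun z : Fin c → ℂ => ‖z i‖) 4
      (Measure.pi fun _ : Fin c => complexGaussian (σ ^ 2)) := fun i =>
    h1.comp_measurePreserving (measurePreserving_eval (fun _ : Fin c => complexGaussian (σ ^ 2)) i)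
  have h3 : ∀ i, MemLp (fun u : (Fin M → Fin K → ℂ) × (Fin c → ℂ) => ‖u.2 i‖) 4
      (roundLaw K M c G σ) := fun i => (h2 i).comp_measurePreserving measurePreserving_snd
  have : IsProbabilityMeasure (roundLaw K M c G σ) := by unfold roundLaw; infer_instance
  have h4 : ∀ i, MemLp (fun u : (Fin M → Fin K → ℂ) × (Fin c → ℂ) =>
      √(K * κ ^ 2) + ν / √Pmin * ‖u.2 i‖) 4 (roundLaw K M c G σ) := fun i => by
    have h5 : MemLp (fun u : (Fin M → Fin K → ℂ) × (Fin c → ℂ) => ν / √Pmin * ‖u.2 i‖) 4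
      (roundLaw K M c G σ) := (h3 i).const_mul _
    have h6 : MemLp (fun _ : (Fin M → Fin K → ℂ) × (Fin c → ℂ) => √(K * κ ^ 2)) 4
      (roundLaw K M c G σ) := memLp_const _
    exact h6.add h5
  have h5 := memLp_finsetSum Finset.univ fun i _ => h4 i
  exact h5

theorem ae_pi_gainLaw {G : ℝ} [IsProbabilityMeasure (gainLaw K G)] :
    ∀ᵐ h ∂(Measure.pi fun _ : Fin M => gainLaw K G),
      ∀ s, (∃ k, G ≤ ‖h s k‖ ^ 2) ∧ ∀ k, h s k ≠ 0 := by
  rw [ae_all_iff]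
  exact fun s => (measurePreserving_eval (fun _ : Fin M => gainLaw K G)
    s).quasiMeasurePreserving.ae ae_gainLaw

/-- The error of the received gradient in one round with receive power `p`, gains `u.1` and
receiver noise `u.2`. -/
noncomputable def roundNoise (e : Fin D × Fin d ≃ Fin c × Fin 2) (sub : Fin c → Fin M) (G : ℝ)
    (η : ℂ) (ν : ℝ) (Fk : Fin K → Mat D d → ℝ) (W : Mat D d) (p : ℝ)
    (u : (Fin M → Fin K → ℂ) × (Fin c → ℂ)) : Mat D d :=
  uncvec e (receivedGradient e sub G η ν Fk W p u.1 u.2) - gradient (globalObj Fk) W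

theorem measurable_roundNoise (sub : Fin c → Fin M) (G : ℝ) (η : ℂ) (ν : ℝ) :
    Measurable fun x : (Mat D d × ℝ) × (Fin M → Fin K → ℂ) × (Fin c → ℂ) =>
      roundNoise e sub G η ν Fk x.1.1 x.1.2 x.2 :=
  ((measurable_uncvec e).comp (measurable_receivedGradient sub G η ν)).sub
    ((measurable_gradient _).comp (by fun_prop))

theorem roundNoise_eq (sub : Fin c → Fin M) {G ν p : ℝ} (η : ℂ) (hν : 0 < ν) (hp : 0 < p)
    (W : Mat D d) {u : (Fin M → Fin K → ℂ) × (Fin c → ℂ)}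
    (hu : ∀ s, (∃ k, G ≤ ‖u.1 s k‖ ^ 2) ∧ ∀ k, u.1 s k ≠ 0) :
    roundNoise e sub G η ν Fk W p u =
      uncvec e fun i => ∑ k, (weight G k (u.1 (sub i)) : ℂ) * dataNoise e Fk k W i +
        ((ν / (numActive G (u.1 (sub i)) * √p) : ℝ) : ℂ) * u.2 i := by
  have h1 : roundNoise e sub G η ν Fk W p u = uncvec e (receivedGradient e sub G η ν Fk W p u.1 u.2
      - cvec e (gradient (globalObj Fk) W)) := by rw [uncvec_sub, uncvec_cvec, roundNoise]
  rw [h1]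
  congr 1
  funext i
  exact receivedGradient_sub sub η hν hp W u.2 i (hu _).1 (hu _).2

theorem norm_roundNoise_le (hK : 0 < K) (sub : Fin c → Fin M) {G κ ν Pmin p : ℝ} (η : ℂ)
    (hν : 0 < ν) (hPmin : 0 < Pmin) (hp : Pmin ≤ p) (hκ : DataNoiseBound e Fk κ) (W : Mat D d)
    {u : (Fin M → Fin K → ℂ) × (Fin c → ℂ)}
    (hu : ∀ s, (∃ k, G ≤ ‖u.1 s k‖ ^ 2) ∧ ∀ k, u.1 s k ≠ 0) :
    ‖roundNoise e sub G η ν Fk W p u‖ ≤ noiseBound M κ ν Pmin u := by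
  rw [roundNoise_eq sub η hν (hPmin.trans_le hp) W hu]
  refine (norm_uncvec_le e _).trans (Finset.sum_le_sum fun i _ => (norm_add_le _ _).trans ?_)
  gcongr
  · calc ‖∑ k, (weight G k (u.1 (sub i)) : ℂ) * dataNoise e Fk k W i‖
        ≤ ∑ k, ‖(weight G k (u.1 (sub i)) : ℂ) * dataNoise e Fk k W i‖ := norm_sum_le _ _
      _ ≤ ∑ k, weight G k (u.1 (sub i)) * √(K * κ ^ 2) := by
          refine Finset.sum_le_sum fun k _ => ?_
          rw [norm_mul, Complex.norm_real, Real.norm_eq_abs, abs_of_nonneg (weight_nonneg _ _)]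
          exact mul_le_mul_of_nonneg_left
            (Real.le_sqrt_of_sq_le (norm_dataNoise_sq_le hK hκ k W i)) (weight_nonneg _ _)
      _ = _ := by rw [← Finset.sum_mul, sum_weight (hu _).1, one_mul]
  · rw [norm_mul, Complex.norm_real, Real.norm_eq_abs, abs_of_nonneg (by positivity)]
    have h1 : (1 : ℝ) ≤ numActive G (u.1 (sub i)) := by
      exact_mod_cast numActive_pos (hu (sub i)).1
    have h2 : √Pmin ≤ √p := Real.sqrt_le_sqrt hp
    have h3 : 0 < √Pmin := Real.sqrt_pos.2 hPmin
    have h4 : √Pmin ≤ numActive G (u.1 (sub i)) * √p := by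
      calc √Pmin ≤ √p := h2
        _ ≤ _ := le_mul_of_one_le_left (Real.sqrt_nonneg _) h1
    gcongr

/-- The noise of one round along a direction is affine in the receiver noise. -/
theorem inner_roundNoise (sub : Fin c → Fin M) {G ν p : ℝ} (η : ℂ) (hν : 0 < ν) (hp : 0 < p)
    (W v : Mat D d) {h : Fin M → Fin K → ℂ}
    (hh : ∀ s, (∃ k, G ≤ ‖h s k‖ ^ 2) ∧ ∀ k, h s k ≠ 0) (z : Fin c → ℂ) :
    inner ℝ v (roundNoise e sub G η ν Fk W p (h, z)) =
      ∑ i, ∑ k, weight G k (h (sub i)) * ((cvec e v i).re * (dataNoise e Fk k W i).re +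
        (cvec e v i).im * (dataNoise e Fk k W i).im) +
      ∑ i, (ν / (numActive G (h (sub i)) * √p) * (cvec e v i).re * (z i).re +
        ν / (numActive G (h (sub i)) * √p) * (cvec e v i).im * (z i).im) := by
  rw [roundNoise_eq sub η hν hp W (u := (h, z)) hh, inner_uncvec, ← Finset.sum_add_distrib]
  refine Finset.sum_congr rfl fun i _ => ?_
  simp only [Complex.add_re, Complex.add_im, Complex.re_sum, Complex.im_sum,
    Complex.re_ofReal_mul, Complex.im_ofReal_mul, mul_add, Finset.mul_sum,
    Finset.sum_add_distrib]
  simp only [mul_left_comm, mul_assoc]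
  ring

/-- By exchangeability all devices have the same mean weight, which factors out and leaves the sum
of the data noise, equal to zero. -/
theorem integral_sum_weight_mul_dataNoise (hK : 0 < K) {G : ℝ} [IsProbabilityMeasure (gainLaw K G)]
    (sub : Fin c → Fin M) (hF : ∀ k, Differentiable ℝ (Fk k)) (W v : Mat D d) :
    ∫ h, ∑ i, ∑ k, weight G k (h (sub i)) * ((cvec e v i).re * (dataNoise e Fk k W i).re +
      (cvec e v i).im * (dataNoise e Fk k W i).im) ∂(Measure.pi fun _ : Fin M => gainLaw K G) =
      0 := by
  have hwi : ∀ i k, Integrable (fun h : Fin M → Fin K → ℂ => weight G k (h (sub i)))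
      (Measure.pi fun _ : Fin M => gainLaw K G) := fun i k =>
    integrable_comp_eval (μ := fun _ : Fin M => gainLaw K G) (i := sub i) (integrable_weight k)
  have hw : ∀ i k, ∫ h : Fin M → Fin K → ℂ, weight G k (h (sub i))
      ∂(Measure.pi fun _ : Fin M => gainLaw K G) =
      ∫ x, weight G ⟨0, hK⟩ x ∂(gainLaw K G) := fun i k => by
    rw [integral_comp_eval (μ := fun _ : Fin M => gainLaw K G) (i := sub i)
      (measurable_weight k).aestronglyMeasurable]
    exact integral_weight_eq _ _
  rw [integral_finsetSum _ fun i _ => integrable_finsetSum _ fun k _ => (hwi i k).mul_const _]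
  refine Finset.sum_eq_zero fun i _ => ?_
  rw [integral_finsetSum _ fun k _ => (hwi i k).mul_const _]
  simp_rw [integral_mul_const, hw]
  rw [← Finset.mul_sum, Finset.sum_add_distrib, ← Finset.mul_sum, ← Finset.mul_sum,
    ← Complex.re_sum, ← Complex.im_sum, sum_dataNoise hK hF]
  simp

theorem isProbabilityMeasure_roundLaw {G : ℝ} [IsProbabilityMeasure (gainLaw K G)] (σ : ℝ) :
    IsProbabilityMeasure (roundLaw K M c G σ) := by
  unfold roundLaw; infer_instance

theorem ae_norm_roundNoise_le (hK : 0 < K) {G κ ν σ Pmin p : ℝ}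
    [IsProbabilityMeasure (gainLaw K G)] (sub : Fin c → Fin M) (η : ℂ)
    (hν : 0 < ν) (hPmin : 0 < Pmin) (hp : Pmin ≤ p) (hκ : DataNoiseBound e Fk κ) (W : Mat D d) :
    ∀ᵐ u ∂(roundLaw K M c G σ), ‖roundNoise e sub G η ν Fk W p u‖ ≤ noiseBound M κ ν Pmin u := by
  have hgood : ∀ᵐ u ∂(roundLaw K M c G σ), ∀ s, (∃ k, G ≤ ‖u.1 s k‖ ^ 2) ∧ ∀ k, u.1 s k ≠ 0 :=
    measurePreserving_fst.quasiMeasurePreserving.ae ae_pi_gainLaw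
  filter_upwards [hgood] with u hu using norm_roundNoise_le hK sub η hν hPmin hp hκ W hu

/-- Given the gains, the error is affine in the receiver noise, so the latter is integrated first.
The variance bound corresponds to the worst case of `K` active devices and power `Pmax`; like the
dominating function, it is uniform in `W` and `p`. -/
theorem isNoise_roundNoise (hK : 0 < K) {G κ ν σ Pmin Pmax p : ℝ}
    [IsProbabilityMeasure (gainLaw K G)] (sub : Fin c → Fin M) (η : ℂ)
    (hν : 0 < ν) (hPmin : 0 < Pmin) (hp : p ∈ Set.Icc Pmin Pmax)
    (hF : ∀ k, Differentiable ℝ (Fk k)) (hκ : DataNoiseBound e Fk κ) (W : Mat D d) :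
    IsNoise (roundLaw K M c G σ) (noiseBound M κ ν Pmin) (ν ^ 2 * σ ^ 2 / (2 * K ^ 2 * Pmax))
      (roundNoise e sub G η ν Fk W p) := by
  have hp0 : 0 < p := hPmin.trans_le hp.1
  have hK' : (0 : ℝ) < K := by exact_mod_cast hK
  have hmeas : Measurable (roundNoise e sub G η ν Fk W p) := by
    have h1 : Measurable (fun u : (Fin M → Fin K → ℂ) × (Fin c → ℂ) => ((W, p), u)) :=
      measurable_prodMk_left
    simpa only [Function.comp_def] using
      (measurable_roundNoise (e := e) (Fk := Fk) sub G η ν).comp h1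
  have hbound : ∀ᵐ u ∂(roundLaw K M c G σ),
      ‖roundNoise e sub G η ν Fk W p u‖ ≤ noiseBound M κ ν Pmin u :=
    ae_norm_roundNoise_le hK sub η hν hPmin hp.1 hκ W
  have hD : MemLp (noiseBound M κ ν Pmin) 4 (roundLaw K M c G σ) := memLp_noiseBound σ κ ν Pmin
  have hLp : MemLp (roundNoise e sub G η ν Fk W p) 4 (roundLaw K M c G σ) :=
    hD.mono hmeas.aestronglyMeasurable (hbound.mono fun u hu => hu.trans (le_abs_self _))
  have : IsProbabilityMeasure (roundLaw K M c G σ) := isProbabilityMeasure_roundLaw σ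
  have hinner : ∀ v, MemLp (fun u => inner ℝ v (roundNoise e sub G η ν Fk W p u)) 4
      (roundLaw K M c G σ) := fun v => hLp.const_inner v
  have hgood := ae_pi_gainLaw (M := M) (K := K) (G := G)
  refine ⟨hmeas.aestronglyMeasurable, hbound, fun v => ?_, fun v => ?_⟩
  · have hi : Integrable (fun u => inner ℝ v (roundNoise e sub G η ν Fk W p u))
      (roundLaw K M c G σ) := (hinner v).integrable (by norm_num)
    unfold roundLaw at hi ⊢
    rw [integral_prod _ hi]
    refine Eq.trans (integral_congr_ae ?_) (integral_sum_weight_mul_dataNoise (e := e) hK sub hF W v)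
    filter_upwards [hgood] with h hh
    simp_rw [inner_roundNoise sub η hν hp0 W v hh]
    rw [integral_add (integrable_const _)
      ((memLp_linear_pi_complexGaussian _ _ _ (p := 1) (by simp)).integrable le_rfl),
      integral_linear_pi_complexGaussian, integral_const, probReal_univ, one_smul, add_zero]
  · have h2 : MemLp (fun u => inner ℝ v (roundNoise e sub G η ν Fk W p u)) 2
      (roundLaw K M c G σ) := (hinner v).mono_exponent (by norm_num)
    have hi := h2.integrable_sq
    unfold roundLaw at hi ⊢
    rw [integral_prod _ hi]
    have h1 : ∀ᵐ h ∂(Measure.pi fun _ : Fin M => gainLaw K G),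
        ν ^ 2 * σ ^ 2 / (2 * K ^ 2 * Pmax) * ‖v‖ ^ 2 ≤
        ∫ z, inner ℝ v (roundNoise e sub G η ν Fk W p (h, z)) ^ 2
          ∂(Measure.pi fun _ : Fin c => complexGaussian (σ ^ 2)) := by
      filter_upwards [hgood] with h hh
      simp_rw [inner_roundNoise sub η hν hp0 W v hh]
      refine le_trans ?_ (le_integral_sq_linear_pi_complexGaussian (sq_nonneg σ) _ _ _)
      rw [norm_sq_eq_sum_cvec e v, Finset.mul_sum, Finset.mul_sum]
      refine Finset.sum_le_sum fun i _ => ?_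
      have hX1 : (0 : ℝ) < numActive G (h (sub i)) := by exact_mod_cast numActive_pos (hh _).1
      have hXK : (numActive G (h (sub i)) : ℝ) ≤ K := by exact_mod_cast numActive_le _
      rw [mul_pow, mul_pow, ← mul_add, ← mul_assoc]
      gcongr
      rw [div_pow, mul_pow, Real.sq_sqrt hp0.le]
      calc ν ^ 2 * σ ^ 2 / (2 * K ^ 2 * Pmax) = σ ^ 2 / 2 * (ν ^ 2 / (K ^ 2 * Pmax)) := by
            field_simp
        _ ≤ _ := by gcongr; exact hp.2
    have h3 := integral_mono_ae (integrable_const _) hi.integral_prod_left h1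
    rwa [integral_const, probReal_univ, one_smul] at h3

end Round

/-! ### Integrating out an independent variable -/

section Independent

variable {Ω α U : Type*} {m mΩ : MeasurableSpace Ω} [MeasurableSpace α] [MeasurableSpace U]
  {P : Measure Ω} [IsProbabilityMeasure P]

/-- An event of the past can be absorbed into the `X`-part of a rectangle, so independence survives
restriction to it. This avoids regular conditional distributions. -/
theorem map_restrict_prodMk_eq_prod (hm : m ≤ mΩ) {X : Ω → α} (hX : Measurable[m] X) {Y : Ω → U}
    (hY : Measurable Y) (hind : Indep m (MeasurableSpace.comap Y inferInstance) P) {A : Set Ω}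
    (hA : MeasurableSet[m] A) :
    (P.restrict A).map (fun ω => (X ω, Y ω)) = ((P.restrict A).map X).prod (P.map Y) := by
  have hX' : Measurable X := hX.mono hm le_rfl
  have : IsProbabilityMeasure (P.map Y) := Measure.isProbabilityMeasure_map hY.aemeasurable
  symm
  refine Measure.prod_eq fun s t hs ht => ?_
  rw [Measure.map_apply (hX'.prodMk hY) (hs.prod ht), Measure.map_apply hX' hs,
    Measure.map_apply hY ht, Measure.restrict_apply ((hX'.prodMk hY) (hs.prod ht)),
    Measure.restrict_apply (hX' hs)]
  have h := (Indep_iff _ _ _).1 hind (X ⁻¹' s ∩ A) (Y ⁻¹' t) ((hX hs).inter hA) ⟨t, ht, rfl⟩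
  rw [← h]
  congr 1
  ext ω
  simp only [Set.mem_inter_iff, Set.mem_preimage, Set.mem_prod]
  tauto

theorem setIntegral_indep (hm : m ≤ mΩ) {X : Ω → α} (hX : Measurable[m] X)
    {Y : Ω → U} (hY : Measurable Y) (hind : Indep m (MeasurableSpace.comap Y inferInstance) P)
    {A : Set Ω} (hA : MeasurableSet[m] A) {Ψ : α × U → ℝ} (hΨ : Measurable Ψ)
    (hint : IntegrableOn (fun ω => Ψ (X ω, Y ω)) A P) :
    IntegrableOn (fun ω => ∫ u, Ψ (X ω, u) ∂(P.map Y)) A P ∧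
      ∫ ω in A, Ψ (X ω, Y ω) ∂P = ∫ ω in A, ∫ u, Ψ (X ω, u) ∂(P.map Y) ∂P := by
  have hX' : Measurable X := hX.mono hm le_rfl
  have hXY := (hX'.prodMk hY).aemeasurable (μ := P.restrict A)
  have hmap := map_restrict_prodMk_eq_prod hm hX hY hind hA
  have : IsProbabilityMeasure (P.map Y) := Measure.isProbabilityMeasure_map hY.aemeasurable
  have h1 : Integrable Ψ (((P.restrict A).map X).prod (P.map Y)) := by
    rw [← hmap]
    exact (integrable_map_measure hΨ.aestronglyMeasurable hXY).2 hint
  have h2 := h1.integral_prod_left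
  constructor
  · exact (integrable_map_measure h2.1 hX'.aemeasurable).1 h2
  · calc ∫ ω in A, Ψ (X ω, Y ω) ∂P = ∫ y, Ψ y ∂((P.restrict A).map fun ω => (X ω, Y ω)) :=
          (integral_map hXY hΨ.aestronglyMeasurable).symm
      _ = ∫ x, ∫ u, Ψ (x, u) ∂(P.map Y) ∂((P.restrict A).map X) := by
          rw [hmap, integral_prod _ h1]
      _ = _ := integral_map hX'.aemeasurable h2.1

end Independent

/-! ### The descent path -/

section Path

variable {Ω : Type*} {D d c K M : ℕ}
  {e : Fin D × Fin d ≃ Fin c × Fin 2} {sub : Fin c → Fin M} {G ν Pmin Pmax μ : ℝ} {η : ℂ}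
  {Fk : Fin K → Mat D d → ℝ} {h : ℕ → Ω → Fin M → Fin K → ℂ} {z : ℕ → Ω → Fin c → ℂ}
  {Prx : ℕ → Ω → ℝ} {W₀ : Mat D d}

theorem past_mono {n n' : ℕ} (hn : n ≤ n') : past h z n ≤ past h z n' :=
  iSup_le fun j => le_iSup_of_le (Fin.castLE hn j) le_rfl

theorem measurable_past_succ (n : ℕ) :
    Measurable[past h z (n + 1)] fun ω => (h n ω, z n ω) := by
  have h1 : MeasurableSpace.comap (fun ω => (h n ω, z n ω)) inferInstance ≤ past h z (n + 1) :=
    le_iSup (fun j : Fin (n + 1) => MeasurableSpace.comap (fun ω => (h j ω, z j ω)) inferInstance)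
      (Fin.last n)
  exact (comap_measurable _).mono h1 le_rfl

theorem path_succ (n : ℕ) (ω : Ω) :
    path e sub G η ν Fk μ h z Prx W₀ (n + 1) ω = path e sub G η ν Fk μ h z Prx W₀ n ω -
      μ • (gradient (globalObj Fk) (path e sub G η ν Fk μ h z Prx W₀ n ω) +
        roundNoise e sub G η ν Fk (path e sub G η ν Fk μ h z Prx W₀ n ω) (Prx n ω)
          (h n ω, z n ω)) := by
  rw [roundNoise, add_sub_cancel]
  rfl

theorem measurable_step (sub : Fin c → Fin M) (G : ℝ) (η : ℂ) (ν μ : ℝ) :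
    Measurable fun x : (Mat D d × ℝ) × (Fin M → Fin K → ℂ) × (Fin c → ℂ) =>
      x.1.1 - μ • (gradient (globalObj Fk) x.1.1 + roundNoise e sub G η ν Fk x.1.1 x.1.2 x.2) := by
  have h1 := measurable_roundNoise (e := e) (Fk := Fk) sub G η ν
  have h2 : Measurable fun x : (Mat D d × ℝ) × (Fin M → Fin K → ℂ) × (Fin c → ℂ) =>
      gradient (globalObj Fk) x.1.1 := (measurable_gradient _).comp (by fun_prop)
  exact Measurable.sub (by fun_prop) ((h2.add h1).const_smul μ)

theorem measurable_path (hP : IsPowerControl Pmin Pmax h z Prx) (n : ℕ) :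
    Measurable[past h z n] (path e sub G η ν Fk μ h z Prx W₀ n) := by
  induction n with
  | zero => exact measurable_const
  | succ n ih =>
    have h1 := ih.mono (past_mono n.le_succ) le_rfl
    have h2 := (hP.adapted n).mono (past_mono n.le_succ) le_rfl
    have h3 := (measurable_step (e := e) (Fk := Fk) sub G η ν μ).comp
      ((h1.prodMk h2).prodMk (measurable_past_succ (h := h) (z := z) n))
    have h4 : path e sub G η ν Fk μ h z Prx W₀ (n + 1) = fun ω => _ := funext (path_succ n)
    rw [h4]
    simpa only [Function.comp_def] using h3

end Path

section Path

variable {Ω : Type*} [MeasurableSpace Ω] {P : Measure Ω} {D d c K M : ℕ}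
  {e : Fin D × Fin d ≃ Fin c × Fin 2} {sub : Fin c → Fin M} {G σ κ ν Pmin Pmax μ : ℝ} {η : ℂ}
  {Fk : Fin K → Mat D d → ℝ} {h : ℕ → Ω → Fin M → Fin K → ℂ} {z : ℕ → Ω → Fin c → ℂ}
  {Prx : ℕ → Ω → ℝ} {W₀ : Mat D d}

theorem IsChannel.measurable (hch : IsChannel P G σ h z) (n : ℕ) :
    Measurable fun ω => (h n ω, z n ω) :=
  (hch.measurable_gain n).prodMk (hch.measurable_noise n)

theorem IsChannel.past_le (hch : IsChannel P G σ h z) (n : ℕ) :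
    past h z n ≤ (inferInstance : MeasurableSpace Ω) :=
  iSup_le fun j => (hch.measurable j).comap_le

theorem IsChannel.indep_past (hch : IsChannel P G σ h z) (n : ℕ) :
    Indep (past h z n) (MeasurableSpace.comap (fun ω => (h n ω, z n ω)) inferInstance) P := by
  have h1 := indep_iSup_of_disjoint (fun j => (hch.measurable j).comap_le) hch.indep
    (S := Set.Iio n) (T := {n}) (by simp)
  refine indep_of_indep_of_le_left (indep_of_indep_of_le_right h1 ?_) ?_
  · exact le_iSup₂_of_le n rfl le_rfl
  · exact iSup_le fun j => le_iSup₂_of_le (j : ℕ) j.2 le_rfl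

theorem IsChannel.measurePreserving (hch : IsChannel P G σ h z) (n : ℕ) :
    MeasurePreserving (fun ω => (h n ω, z n ω)) P (roundLaw K M c G σ) :=
  ⟨hch.measurable n, hch.law n⟩

/-- A zero gain law on one sub-channel would make the law of a whole round zero, yet that law is the
image of a probability measure. The index `s` guarantees that the product has a factor. -/
theorem IsChannel.isProbabilityMeasure_gainLaw [IsProbabilityMeasure P]
    (hch : IsChannel P G σ h z) (s : Fin M) : IsProbabilityMeasure (gainLaw K G) := by
  refine isProbabilityMeasure_gainLaw_of_ne_zero fun h0 => ?_
  have h1 : IsProbabilityMeasure (roundLaw K M c G σ) :=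
    (hch.measurePreserving 0).map_eq ▸
      Measure.isProbabilityMeasure_map (hch.measurable 0).aemeasurable
  have h2 : (Measure.pi fun _ : Fin M => gainLaw K G) = 0 := by
    rw [← Measure.measure_univ_eq_zero, h0, Measure.pi_univ]
    exact Finset.prod_eq_zero (Finset.mem_univ s) (by simp)
  have h3 := h1.measure_univ
  simp [roundLaw, h2] at h3

theorem memLp_path [IsProbabilityMeasure P] (hK : 0 < K) (hch : IsChannel P G σ h z)
    [IsProbabilityMeasure (gainLaw K G)]
    (hP : IsPowerControl Pmin Pmax h z Prx) (hν : 0 < ν) (hPmin : 0 < Pmin)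
    (hκ : DataNoiseBound e Fk κ) {C : ℝ} (hC : ∀ W, ‖gradient (globalObj Fk) W‖ ≤ C) (n : ℕ) :
    MemLp (path e sub G η ν Fk μ h z Prx W₀ n) 4 P := by
  have hmeas : ∀ n, Measurable (path e sub G η ν Fk μ h z Prx W₀ n) := fun n =>
    (measurable_path hP n).mono (hch.past_le n) le_rfl
  induction n with
  | zero => exact memLp_const W₀
  | succ n ih =>
    set W := path e sub G η ν Fk μ h z Prx W₀ n with hW
    have h1 : MemLp (fun ω => gradient (globalObj Fk) (W ω)) 4 P :=
      MemLp.of_bound ((measurable_gradient _).comp (hmeas n)).aestronglyMeasurable C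
        (Eventually.of_forall fun ω => hC _)
    have hξm : Measurable fun ω => roundNoise e sub G η ν Fk (W ω) (Prx n ω) (h n ω, z n ω) := by
      have h3 := (measurable_roundNoise (e := e) (Fk := Fk) sub G η ν).comp
        (((hmeas n).prodMk ((hP.adapted n).mono (hch.past_le n) le_rfl)).prodMk (hch.measurable n))
      simpa only [Function.comp_def] using h3
    have hD : MemLp (noiseBound M κ ν Pmin) 4 (roundLaw K M c G σ) := memLp_noiseBound σ κ ν Pmin
    have hD' : MemLp (fun ω => noiseBound M κ ν Pmin (h n ω, z n ω)) 4 P :=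
      hD.comp_measurePreserving (hch.measurePreserving n)
    have hgood : ∀ᵐ u ∂(roundLaw K M c G σ), ∀ s, (∃ k, G ≤ ‖u.1 s k‖ ^ 2) ∧ ∀ k, u.1 s k ≠ 0 :=
      measurePreserving_fst.quasiMeasurePreserving.ae ae_pi_gainLaw
    have hgood' := (hch.measurePreserving n).quasiMeasurePreserving.ae hgood
    have h2 : MemLp (fun ω => roundNoise e sub G η ν Fk (W ω) (Prx n ω) (h n ω, z n ω)) 4 P := by
      refine hD'.mono hξm.aestronglyMeasurable (hgood'.mono fun ω hω => ?_)
      exact (norm_roundNoise_le hK sub η hν hPmin (hP.mem_Icc n ω).1 hκ (W ω) hω).trans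
        (le_abs_self _)
    have h3 : path e sub G η ν Fk μ h z Prx W₀ (n + 1) = fun ω => _ := funext (path_succ n)
    rw [h3]
    exact ih.sub ((h1.add h2).const_smul μ)

/-- Conditioned on an event of the past, the path is a noisy gradient descent. -/
theorem isNoisyDescent_path [IsProbabilityMeasure P] (hK : 0 < K) (hch : IsChannel P G σ h z)
    [IsProbabilityMeasure (gainLaw K G)]
    (hP : IsPowerControl Pmin Pmax h z Prx) (hν : 0 < ν) (hPmin : 0 < Pmin)
    (hF : ∀ k, Differentiable ℝ (Fk k)) (hκ : DataNoiseBound e Fk κ) {C : ℝ}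
    (hC : ∀ W, ‖gradient (globalObj Fk) W‖ ≤ C) {n₀ : ℕ} {A : Set Ω}
    (hA : MeasurableSet[past h z n₀] A) (hPA : P A ≠ 0) :
    IsNoisyDescent P[|A] (roundLaw K M c G σ) (noiseBound M κ ν Pmin)
      (ν ^ 2 * σ ^ 2 / (2 * K ^ 2 * Pmax)) (globalObj Fk) μ
      (fun j => path e sub G η ν Fk μ h z Prx W₀ (n₀ + j)) := by
  have hc0 : (P A)⁻¹ ≠ 0 := ENNReal.inv_ne_zero.2 (measure_ne_top P A)
  have hctop : (P A)⁻¹ ≠ ⊤ := ENNReal.inv_ne_top.2 hPA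
  refine ⟨fun j => ?_, fun j φ ψ hφ hstep hi hi' => ?_⟩
  · exact ((memLp_path hK hch hP hν hPmin hκ hC _).restrict A).smul_measure hctop
  · set n := n₀ + j with hn
    have hAn : MeasurableSet[past h z n] A := past_mono (Nat.le_add_right n₀ j) A hA
    rw [ProbabilityTheory.cond, integrable_smul_measure hc0 hctop] at hi hi'
    rw [ProbabilityTheory.cond, integral_smul_measure, integral_smul_measure]
    refine smul_le_smul_of_nonneg_left ?_ ENNReal.toReal_nonneg
    set W := path e sub G η ν Fk μ h z Prx W₀ with hW
    set Ψ : (Mat D d × ℝ) × (Fin M → Fin K → ℂ) × (Fin c → ℂ) → ℝ := fun x =>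
      φ (x.1.1 - μ • (gradient (globalObj Fk) x.1.1 + roundNoise e sub G η ν Fk x.1.1 x.1.2 x.2))
      with hΨ
    have hΨm : Measurable Ψ := hφ.measurable.comp (measurable_step sub G η ν μ)
    have hrw : ∀ ω, φ (W (n₀ + (j + 1)) ω) = Ψ ((W n ω, Prx n ω), (h n ω, z n ω)) := fun ω => by
      rw [hΨ, hW]
      exact congrArg φ (path_succ n ω)
    simp_rw [hrw] at hi ⊢
    -- The iterate and the receive power are both functions of the past. They are frozen together
    -- while the fresh gains and noise are integrated out.
    obtain ⟨h1, h2⟩ := setIntegral_indep (hch.past_le n) (X := fun ω => (W n ω, Prx n ω))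
      ((measurable_path hP n).prodMk (hP.adapted n)) (hch.measurable n) (hch.indep_past n) hAn hΨm
      hi
    rw [h2]
    refine integral_mono h1 hi' fun ω => ?_
    have h3 := hstep (W n ω) _ (isNoise_roundNoise (e := e) (Fk := Fk) (σ := σ) hK sub η hν hPmin
      (hP.mem_Icc n ω) hF hκ (W n ω))
    rw [(hch.measurePreserving n).map_eq]
    exact h3

end Path

/-! ### Blocks of rounds -/

theorem setIntegral_le_of_integral_cond_le {Ω : Type*} [MeasurableSpace Ω] {P : Measure Ω}
    [IsFiniteMeasure P] {A : Set Ω} {f g : Ω → ℝ} {a : ℝ}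
    (h : P A ≠ 0 → ∫ ω, f ω ∂P[|A] ≤ ∫ ω, g ω ∂P[|A] - a) :
    ∫ ω in A, f ω ∂P ≤ ∫ ω in A, g ω ∂P - a * P.real A := by
  by_cases hA : P A = 0
  · simp [Measure.restrict_eq_zero.2 hA, measureReal_def, hA]
  have h1 := h hA
  have hpos : 0 < P.real A := ENNReal.toReal_pos hA (measure_ne_top P A)
  rw [ProbabilityTheory.cond, integral_smul_measure, integral_smul_measure, ENNReal.toReal_inv,
    ← measureReal_def, smul_eq_mul, smul_eq_mul] at h1
  have h2 := mul_le_mul_of_nonneg_left h1 hpos.le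
  rw [mul_sub, mul_inv_cancel_left₀ hpos.ne', mul_inv_cancel_left₀ hpos.ne'] at h2
  linarith

/-- By second countability, countably many of the balls suffice; made disjoint, they split `A` into
events of `m` on each of which `X` stays close to one point of `S`. This replaces conditioning on
the exact value of `X`. -/
theorem setIntegral_nonneg_of_cover {Ω E : Type*} {m mΩ : MeasurableSpace Ω} {P : Measure Ω}
    [PseudoMetricSpace E] [SecondCountableTopology E] [MeasurableSpace E] [BorelSpace E]
    (hm : m ≤ mΩ) {X : Ω → E} (hX : Measurable[m] X) {S : Set E} {r : ℝ} {f : Ω → ℝ}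
    (hf : Integrable f P)
    (h : ∀ x ∈ S, ∀ A, MeasurableSet[m] A → (∀ ω ∈ A, dist (X ω) x < r) → 0 ≤ ∫ ω in A, f ω ∂P)
    {A : Set Ω} (hA : MeasurableSet[m] A) (hAS : ∀ ω ∈ A, X ω ∈ ⋃ x ∈ S, Metric.ball x r) :
    0 ≤ ∫ ω in A, f ω ∂P := by
  obtain ⟨T, hTS, hTc, hT⟩ := TopologicalSpace.isOpen_biUnion_countable S
    (fun x => Metric.ball x r) (fun _ _ => Metric.isOpen_ball)
  rcases T.eq_empty_or_nonempty with rfl | hne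
  · have : A = ∅ := Set.eq_empty_of_forall_notMem fun ω hω => by
      have := hAS ω hω
      rw [← hT] at this
      simp at this
    simp [this]
  obtain ⟨x, rfl⟩ := hTc.exists_eq_range hne
  set s : ℕ → Set Ω := fun k => A ∩ X ⁻¹' disjointed (fun k => Metric.ball (x k) r) k with hs
  have hball : ∀ k, MeasurableSet (disjointed (fun k => Metric.ball (x k) r) k) := fun k =>
    MeasurableSet.disjointed (fun _ => measurableSet_ball) k
  have hsm : ∀ k, MeasurableSet[m] (s k) := fun k => hA.inter (hX (hball k))
  have hsU : A = ⋃ k, s k := by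
    rw [hs, ← Set.inter_iUnion, ← Set.preimage_iUnion, iUnion_disjointed]
    symm
    rw [Set.inter_eq_left]
    intro ω hω
    have := hAS ω hω
    rw [← hT] at this
    simpa using this
  rw [hsU, integral_iUnion (fun k => hm _ (hsm k)) (fun i j hij => ?_) hf.integrableOn]
  · refine tsum_nonneg fun k => h (x k) (hTS ⟨k, rfl⟩) _ (hsm k) fun ω hω => ?_
    have h1 : X ω ∈ disjointed (fun k => Metric.ball (x k) r) k := hω.2
    exact disjointed_subset _ k h1
  · exact ((disjoint_disjointed (fun k => Metric.ball (x k) r) hij).preimage X).mono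
      Set.inter_subset_right Set.inter_subset_right

/-- If the expectation of a bounded function decreases by `a` per block as long as the process has
not left `O` at the block ends, then the process is unlikely to stay in `O`. -/
theorem measureReal_forall_mem_le {Ω E : Type*} [MeasurableSpace Ω] [MeasurableSpace E]
    {P : Measure Ω} [IsProbabilityMeasure P] {V : ℕ → Ω → E} (hV : ∀ i, Measurable (V i))
    {O : Set E} (hO : MeasurableSet O) {F : E → ℝ} (hFm : Measurable F) {B a : ℝ}
    (hB : ∀ w, ‖F w‖ ≤ B) (ha : 0 < a)
    (hdrop : ∀ i, ∫ ω in {ω | ∀ j ≤ i, V j ω ∈ O}, F (V (i + 1) ω) ∂P ≤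
      ∫ ω in {ω | ∀ j ≤ i, V j ω ∈ O}, F (V i ω) ∂P - a * P.real {ω | ∀ j ≤ i, V j ω ∈ O})
    (i : ℕ) : P.real {ω | ∀ j ≤ i, V j ω ∈ O} ≤ 2 * B / ((i + 1) * a) := by
  set A : ℕ → Set Ω := fun i => {ω | ∀ j ≤ i, V j ω ∈ O} with hAdef
  have hA : ∀ i, MeasurableSet (A i) := fun i => by
    have : A i = ⋂ j ≤ i, V j ⁻¹' O := by ext; simp [hAdef]
    rw [this]
    exact MeasurableSet.iInter fun j => MeasurableSet.iInter fun _ => hV j hO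
  have hAanti : ∀ i, A (i + 1) ⊆ A i := fun i ω hω j hj => hω j (hj.trans i.le_succ)
  have hint : ∀ i, Integrable (fun ω => F (V i ω)) P := fun i =>
    Integrable.of_bound (hFm.comp (hV i)).aestronglyMeasurable B (Eventually.of_forall fun _ => hB _)
  -- Shifting by `B` makes the integrand nonnegative, so shrinking the event from `A i` to `A (i +
  -- 1)` can only decrease the integral and the drops telescope.
  have hnn : ∀ w, 0 ≤ F w + B := fun w => by linarith [(abs_le.1 (hB w)).1]
  set u : ℕ → ℝ := fun i => ∫ ω in A i, (F (V i ω) + B) ∂P with hu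
  have hadd : ∀ i j, ∫ ω in A i, (F (V j ω) + B) ∂P = ∫ ω in A i, F (V j ω) ∂P + P.real (A i) * B :=
    fun i j => by
      rw [integral_add (hint j).integrableOn (integrable_const _)]
      simp
  have hstep : ∀ i, u (i + 1) + a * P.real (A i) ≤ u i := fun i => by
    have h1 : u (i + 1) ≤ ∫ ω in A i, (F (V (i + 1) ω) + B) ∂P :=
      setIntegral_mono_set ((hint _).add (integrable_const _)).integrableOn
        (Eventually.of_forall fun ω => hnn _) (hAanti i).eventuallyLE
    have h2 := hdrop i
    rw [hadd] at h1
    have h3 : u i = _ := hadd i i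
    rw [h3]
    linarith
  have hsum : ∀ n, u n + ∑ j ∈ Finset.range n, a * P.real (A j) ≤ u 0 := fun n => by
    induction n with
    | zero => simp
    | succ n ih => rw [Finset.sum_range_succ]; linarith [hstep n]
  have hanti : Antitone fun i => P.real (A i) := antitone_nat_of_succ_le fun i =>
    measureReal_mono (hAanti i)
  have hu0 : u 0 ≤ 2 * B := by
    have h1 : u 0 ≤ ∫ ω in A 0, 2 * B ∂P :=
      setIntegral_mono ((hint _).add (integrable_const _)).integrableOn (integrable_const _)
        fun ω => by linarith [(abs_le.1 (hB (V 0 ω))).2]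
    have hB0 : 0 ≤ 2 * B := by
      obtain ⟨ω⟩ : Nonempty Ω := P.nonempty_of_neZero
      linarith [(norm_nonneg _).trans (hB (V 0 ω))]
    rw [setIntegral_const, smul_eq_mul] at h1
    exact h1.trans (mul_le_of_le_one_left hB0 measureReal_le_one)
  have hle : (i + 1) * (a * P.real (A i)) ≤ ∑ j ∈ Finset.range (i + 1), a * P.real (A j) := by
    have := Finset.card_nsmul_le_sum (Finset.range (i + 1)) (fun j => a * P.real (A j))
      (a * P.real (A i)) fun j hj => by
        have := hanti (Nat.lt_succ_iff.1 (Finset.mem_range.1 hj))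
        gcongr
    simpa using this
  have hui : 0 ≤ u (i + 1) := integral_nonneg fun ω => hnn _
  rw [le_div_iff₀ (by positivity)]
  linarith [hsum (i + 1)]

/-! ### Improvable points -/

theorem exists_eigenvector_of_minEigenvalue_le {D d : ℕ} {T : Mat D d →L[ℝ] Mat D d} {γ : ℝ}
    (hγ : 0 < γ) (h : minEigenvalue T ≤ -γ) : ∃ t ≤ -γ, ∃ v, ‖v‖ = 1 ∧ T v = t • v := by
  rw [minEigenvalue] at h
  have hfin := Module.End.finite_hasEigenvalue (f := (T : Mat D d →ₗ[ℝ] Mat D d))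
  rcases Set.eq_empty_or_nonempty
    {t : ℝ | Module.End.HasEigenvalue (T : Mat D d →ₗ[ℝ] Mat D d) t} with h0 | hne
  -- Without eigenvalues the infimum would be 0 by convention, which is not at most `-γ`. Otherwise
  -- the spectrum is finite and the infimum is attained.
  · rw [h0, Real.sInf_empty] at h
    linarith
  obtain ⟨v, hv⟩ := Module.End.HasEigenvalue.exists_hasEigenvector (hne.csInf_mem hfin)
  have hv0 : ‖v‖ ≠ 0 := norm_ne_zero_iff.2 hv.2
  refine ⟨_, h, ‖v‖⁻¹ • v, by rw [norm_smul, norm_inv, norm_norm, inv_mul_cancel₀ hv0], ?_⟩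
  have h2 : T v = _ := hv.apply_eq_smul
  rw [map_smul, h2, smul_comm]

theorem IsStrictSaddle.isImprovable {D d : ℕ} {α γ ε δ : ℝ} {F : Mat D d → ℝ}
    (hF : IsStrictSaddle α γ ε δ F) (hγ : 0 < γ) {x : Mat D d} (hx : x ∉ optRegion α δ F) :
    IsImprovable γ ε F x := by
  rcases hF.trichotomy x with h | h | ⟨Wstar, h1, h2, h3⟩
  · exact Or.inl h
  · exact Or.inr (exists_eigenvector_of_minEigenvalue_le hγ h)
  · exact absurd ⟨Wstar, h1, h2, h3 x h2⟩ hx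

/-! ### Arithmetic of the number of rounds -/

/-- The blocks cover `N - 1 ≥ N / 2` rounds, each block having at most `2 * τ / μ`; hence `(i + 1) *
τ ≥ N * μ / 4`. With this `A₀` the total drop is at least `3 / 8 * (m * μ * V)`, and `m + 1 ≤ 2 * m
≤ 6 * (3 / 8) * m` together with `ρ ≤ 1` gives the constant 12. -/
theorem blocks_le_bound {A₀ τ μ γ L V ρ B N : ℝ} {m T i : ℕ} (hμ : 0 < μ) (hτ : 0 < τ)
    (hγ : 0 < γ) (hL : 0 < L) (hV : 0 < V) (hρ : 0 < ρ) (hρ1 : ρ ≤ 1) (hB : 0 ≤ B)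
    (hA₀ : A₀ = 3 * γ * V / L) (hm : 1 ≤ m) (hN : N = m * (1 / (2 * μ * γ) * L)) (hN2 : 2 ≤ N)
    (hT : T ≤ 2 * τ / μ) (hi : N - 1 < (i + 1) * T) :
    2 * B / ((i + 1) * (A₀ * τ * μ)) ≤ 12 * B / ((m + 1) * μ * ρ * V) := by
  have hm' : (1 : ℝ) ≤ m := by exact_mod_cast hm
  have h1 : N * μ / 4 ≤ (i + 1) * τ := by
    have h2 : N - 1 ≤ (i + 1) * (2 * τ / μ) := hi.le.trans (by gcongr)
    have h3 : (N - 1) * μ ≤ (i + 1) * (2 * τ) := by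
      calc (N - 1) * μ ≤ (i + 1) * (2 * τ / μ) * μ := by gcongr
        _ = _ := by field_simp
    have h4 : N / 2 * μ ≤ (N - 1) * μ := by gcongr; linarith
    linarith
  have h5 : N * μ / 4 = m * L / (8 * γ) := by rw [hN]; field_simp; norm_num
  rw [h5] at h1
  have h6 : A₀ * μ * (m * L / (8 * γ)) ≤ A₀ * μ * ((i + 1) * τ) := by
    rw [hA₀]; gcongr
  have h7 : A₀ * μ * (m * L / (8 * γ)) = 3 / 8 * (m * μ * V) := by
    rw [hA₀]; field_simp
  have hA₀pos : 0 < A₀ := by rw [hA₀]; positivity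
  rw [div_le_div_iff₀ (by positivity) (by positivity)]
  have h8 : (m + 1) * μ * ρ * V ≤ 6 * ((i + 1) * (A₀ * τ * μ)) := by
    have e1 : (m + 1) * μ * ρ * V ≤ (m + 1) * μ * 1 * V := by gcongr
    have e2 : 1 * (μ * V) ≤ m * (μ * V) := by gcongr
    have e3 : 0 ≤ m * (μ * V) := by positivity
    linarith
  have := mul_le_mul_of_nonneg_left h8 (by linarith : 0 ≤ 2 * B)
  linarith

theorem tendsto_one_sub_div_atTop (a b : ℝ) :
    Tendsto (fun m : ℕ => 1 - a / (((m : ℝ) + 1) * b)) atTop (𝓝 1) := by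
  have h := (tendsto_one_div_add_atTop_nhds_zero_nat (𝕜 := ℝ)).const_mul (a / b)
  have h2 := h.const_sub 1
  simp only [mul_zero, sub_zero] at h2
  refine h2.congr fun m => ?_
  rw [div_mul_div_comm, mul_one, mul_comm b]

end AirPCA

/-! ### Assembly of the theorem -/

theorem theorem3
    (D d c K M : ℕ) (hc : 0 < c) (hK : 0 < K)
    (G κ ν σ Pmin Pmax : ℝ) (hG : 0 ≤ G) (hκ : 0 ≤ κ) (hν : 0 < ν) (hσ : 0 < σ)
    (hPmin : 0 < Pmin) (hPmax : Pmin ≤ Pmax)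
    (α β γ δ ε χ B C : ℝ) (hα : 0 < α) (hβ : 0 < β) (hγ : 0 < γ) (hδ : 0 < δ) (hε : 0 < ε)
    (hχ : 0 < χ) :
    -- the threshold hidden in `μ ≪ 1 / (c V_max)` depends on the above constants only
    ∃ θ : ℝ, 0 < θ ∧
      ∀ (e : Fin D × Fin d ≃ Fin c × Fin 2) (sub : Fin c → Fin M) (η : ℂ)
        (Fk : Fin K → AirPCA.Mat D d → ℝ) (_ : ∀ k, Differentiable ℝ (Fk k))
        (_ : AirPCA.IsStrictSaddle α γ ε δ (AirPCA.globalObj Fk))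
        (_ : AirPCA.IsRegular B C β χ (AirPCA.globalObj Fk))
        (_ : AirPCA.DataNoiseBound e Fk κ)
        (Ω : Type*) [MeasurableSpace Ω] (P : Measure Ω) [IsProbabilityMeasure P]
        (h : ℕ → Ω → Fin M → Fin K → ℂ) (z : ℕ → Ω → Fin c → ℂ)
        (_ : AirPCA.IsChannel P G σ h z)
        (Prx : ℕ → Ω → ℝ) (_ : AirPCA.IsPowerControl Pmin Pmax h z Prx)
        (W₀ : AirPCA.Mat D d) (μ : ℝ) (_ : 0 < μ)
        (_ : μ ≤ θ * (1 / (c * AirPCA.Vmax K G κ ν σ Pmin)))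
        (_ : μ < ε ^ 2 / (4 * β * c * AirPCA.Vmax K G κ ν σ Pmin)),
        (∀ m : ℕ, 1 ≤ m →
          1 - 12 * B / ((m + 1) * μ *
              AirPCA.rho β γ c (AirPCA.Vmax K G κ ν σ Pmin) (AirPCA.Vmin K ν σ Pmax) *
              AirPCA.Vmax K G κ ν σ Pmin) ≤
            P.real (AirPCA.entersWithin (AirPCA.path e sub G η ν Fk μ h z Prx W₀)
              (AirPCA.optRegion α δ (AirPCA.globalObj Fk))
              (m * AirPCA.Nmax μ γ c (AirPCA.Vmax K G κ ν σ Pmin) (AirPCA.Vmin K ν σ Pmax)))) ∧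
        Tendsto (fun m : ℕ =>
            P.real (AirPCA.entersWithin (AirPCA.path e sub G η ν Fk μ h z Prx W₀)
              (AirPCA.optRegion α δ (AirPCA.globalObj Fk))
              (m * AirPCA.Nmax μ γ c (AirPCA.Vmax K G κ ν σ Pmin) (AirPCA.Vmin K ν σ Pmax))))
          atTop (𝓝 1) ∧
        ∀ᵐ ω ∂P, ∃ n : ℕ, AirPCA.path e sub G η ν Fk μ h z Prx W₀ n ω ∈
          AirPCA.optRegion α δ (AirPCA.globalObj Fk) := by
  have hc' : (0 : ℝ) < c := by exact_mod_cast hc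
  have hK' : (0 : ℝ) < K := by exact_mod_cast hK
  have hPmax0 : 0 < Pmax := hPmin.trans_le hPmax
  set V := AirPCA.Vmax K G κ ν σ Pmin with hV
  set v := AirPCA.Vmin K ν σ Pmax with hv
  have hv0 : 0 < v := by rw [hv, AirPCA.Vmin]; positivity
  have hV0 : 0 < V := by
    have := AirPCA.actProb_pos G
    rw [hV, AirPCA.Vmax]
    positivity
  set L := Real.log (6 * c * (V / v) + 1) with hL
  have hL0 : 0 < L := Real.log_pos (by
    have : 0 < 6 * c * (V / v) := by positivity
    linarith)
  set ρ := AirPCA.rho β γ c V v with hρ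
  have hρ1 : ρ ≤ 1 := min_le_right _ _
  have hρ0 : 0 < ρ := lt_min (mul_pos (by positivity) hL0) one_pos
  set A₀ := 3 * γ * V / L with hA₀
  have hA₀0 : 0 < A₀ := by positivity
  obtain ⟨τ, hτ1, μ₀, hμ₀, H⟩ := AirPCA.exists_window (E := AirPCA.Mat D d)
    (AirPCA.roundLaw K M c G σ) (AirPCA.noiseBound M κ ν Pmin) (A := A₀)
    (s := ν ^ 2 * σ ^ 2 / (2 * K ^ 2 * Pmax)) hA₀0.le hβ hγ hχ.le hε (by positivity)
  have hτ0 : 0 < τ := by linarith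
  -- The factor `c * V` cancels the one in the step-size condition. The three bounds on `μ` serve
  -- the window estimate, `1 ≤ τ / μ` and `2 ≤ Nmax`, respectively.
  refine ⟨min (min μ₀ 1) (L / (4 * γ)) * (c * V), by positivity, ?_⟩
  intro e sub η Fk hFk hsad hreg hdata Ω _ P _ h z hch Prx hpow W₀ μ hμ hμθ _
  rw [mul_assoc, mul_one_div_cancel (by positivity), mul_one] at hμθ
  obtain ⟨⟨hμμ₀, hμ1⟩, hμL⟩ : (μ ≤ μ₀ ∧ μ ≤ 1) ∧ μ ≤ L / (4 * γ) := by
    simpa only [le_min_iff] using hμθ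
  set F := AirPCA.globalObj Fk with hF
  set R := AirPCA.optRegion α δ F with hR
  set W := AirPCA.path e sub G η ν Fk μ h z Prx W₀ with hW
  have hB0 : 0 ≤ B := (norm_nonneg _).trans (hreg.bounded 0)
  have : IsProbabilityMeasure (AirPCA.gainLaw K G) :=
    hch.isProbabilityMeasure_gainLaw (sub ⟨0, hc⟩)
  have : IsProbabilityMeasure (AirPCA.roundLaw K M c G σ) :=
    AirPCA.isProbabilityMeasure_roundLaw σ
  have hDLp : MemLp (AirPCA.noiseBound M κ ν Pmin) 4 (AirPCA.roundLaw K M c G σ) :=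
    AirPCA.memLp_noiseBound σ κ ν Pmin
  set T := ⌈τ / μ⌉₊ with hT
  have hT1 : τ / μ ≤ T := Nat.le_ceil _
  have hT2 : (T : ℝ) ≤ 2 * τ / μ := by
    have h1 : (T : ℝ) < τ / μ + 1 := Nat.ceil_lt_add_one (by positivity)
    have h2 : 1 ≤ τ / μ := (one_le_div hμ).2 (by linarith)
    rw [mul_div_assoc]
    linarith
  have hT0 : (0 : ℝ) < T := lt_of_lt_of_le (by positivity) hT1
  -- the complement of the region, slightly enlarged
  set O : Set (AirPCA.Mat D d) := ⋃ x ∈ Rᶜ, Metric.ball x μ with hO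
  have hOm : MeasurableSet O := (isOpen_biUnion fun _ _ => Metric.isOpen_ball).measurableSet
  have hRO : ∀ w, w ∉ O → w ∈ R := fun w hw => by
    by_contra hwR
    exact hw (Set.mem_biUnion hwR (Metric.mem_ball_self hμ))
  have hWm : ∀ n, Measurable[AirPCA.past h z n] (W n) := fun n => AirPCA.measurable_path hpow n
  have hWm' : ∀ n, Measurable (W n) := fun n => (hWm n).mono (hch.past_le n) le_rfl
  have hFm : Measurable F := hsad.differentiable.continuous.measurable
  have hFi : ∀ n, Integrable (fun ω => F (W n ω)) P := fun n =>
    Integrable.of_bound (hFm.comp (hWm' n)).aestronglyMeasurable B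
      (Eventually.of_forall fun _ => hreg.bounded _)
  set a := A₀ * τ * μ with ha
  have ha0 : 0 < a := by positivity
  -- The radius `μ` is the tolerance that the window estimate allows for the starting point; the
  -- estimate is applied under `P` conditioned on `A`.
  have hball : ∀ n x, x ∈ Rᶜ → ∀ A, MeasurableSet[AirPCA.past h z n] A →
      (∀ ω ∈ A, dist (W n ω) x < μ) →
      ∫ ω in A, F (W (n + T) ω) ∂P ≤ ∫ ω in A, F (W n ω) ∂P - a * P.real A := by
    intro n x hx A hA hAx
    refine AirPCA.setIntegral_le_of_integral_cond_le fun hPA => ?_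
    have : IsProbabilityMeasure P[|A] := cond_isProbabilityMeasure hPA
    exact H μ T hμ hμμ₀ hT1 hT2 P[|A] hDLp hsad.differentiable hsad.differentiable_gradient
      hreg.bounded hreg.gradient_bounded hreg.smooth hreg.hessian_smooth
      (AirPCA.isNoisyDescent_path (W₀ := W₀) hK hch hpow hν hPmin hFk hdata hreg.gradient_bounded
        hA hPA) (hsad.isImprovable hγ hx) (by
        filter_upwards [ae_cond_mem (hch.past_le n _ hA)] with ω hω
        rw [← dist_eq_norm]
        exact (hAx ω hω).le)
  have hdrop : ∀ n A, MeasurableSet[AirPCA.past h z n] A → (∀ ω ∈ A, W n ω ∈ O) →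
      ∫ ω in A, F (W (n + T) ω) ∂P ≤ ∫ ω in A, F (W n ω) ∂P - a * P.real A := by
    intro n A hA hAO
    have hsplit : ∀ A, ∫ ω in A, (F (W n ω) - F (W (n + T) ω) - a) ∂P =
        ∫ ω in A, F (W n ω) ∂P - ∫ ω in A, F (W (n + T) ω) ∂P - a * P.real A := fun A => by
      have h1 : IntegrableOn (fun ω => F (W n ω) - F (W (n + T) ω)) A P :=
        ((hFi n).sub (hFi (n + T))).integrableOn
      rw [integral_sub h1 (integrable_const _),
        integral_sub (hFi n).integrableOn (hFi (n + T)).integrableOn]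
      simp [mul_comm]
    have h1 := AirPCA.setIntegral_nonneg_of_cover (P := P) (hch.past_le n) (hWm n) (S := Rᶜ)
      (r := μ) (f := fun ω => F (W n ω) - F (W (n + T) ω) - a)
      (((hFi n).sub (hFi (n + T))).sub (integrable_const a))
      (fun x hx A hA hAx => by
        rw [hsplit]
        linarith [hball n x hx A hA hAx]) hA hAO
    rw [hsplit] at h1
    linarith
  have hbound := AirPCA.measureReal_forall_mem_le (P := P) (V := fun i => W (i * T))
    (fun i => hWm' _) hOm hFm hreg.bounded ha0 (fun i => by
      have h1 := hdrop (i * T) {ω | ∀ j ≤ i, W (j * T) ω ∈ O} (by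
        have h2 : {ω | ∀ j ≤ i, W (j * T) ω ∈ O} = ⋂ j ≤ i, W (j * T) ⁻¹' O := by ext; simp
        rw [h2]
        refine MeasurableSet.iInter fun j => MeasurableSet.iInter fun hj => ?_
        exact AirPCA.past_mono (Nat.mul_le_mul_right T hj) _ (hWm _ hOm))
        (fun ω hω => hω i le_rfl)
      rwa [← Nat.succ_mul] at h1)
  have hAm : ∀ i, MeasurableSet {ω | ∀ j ≤ i, W (j * T) ω ∈ O} := fun i => by
    have h2 : {ω | ∀ j ≤ i, W (j * T) ω ∈ O} = ⋂ j ≤ i, W (j * T) ⁻¹' O := by ext; simp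
    rw [h2]
    exact MeasurableSet.iInter fun j => MeasurableSet.iInter fun _ => hWm' _ hOm
  have hNmax : 2 ≤ AirPCA.Nmax μ γ c V v := by
    rw [AirPCA.Nmax, ← hL, div_mul_eq_mul_div, one_mul, le_div_iff₀ (by positivity)]
    rw [le_div_iff₀ (by positivity)] at hμL
    linarith
  have hmain : ∀ m : ℕ, 1 ≤ m → 1 - 12 * B / ((m + 1) * μ * ρ * V) ≤
      P.real (AirPCA.entersWithin W R (m * AirPCA.Nmax μ γ c V v)) := by
    intro m hm
    have hm' : (1 : ℝ) ≤ m := by exact_mod_cast hm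
    set N := m * AirPCA.Nmax μ γ c V v with hN
    have hN2 : 2 ≤ N := by
      calc (2 : ℝ) ≤ AirPCA.Nmax μ γ c V v := hNmax
        _ ≤ _ := le_mul_of_one_le_left (by linarith) hm'
    -- The last block end `i * T` still lies within the admissible rounds `n ≤ N - 1`. Counting the
    -- start at 0, there are `i + 1` checkpoints.
    set i := ⌊(N - 1) / T⌋₊ with hi
    have hi1 : (i : ℝ) * T ≤ N - 1 := by
      rw [← le_div_iff₀ hT0]
      exact Nat.floor_le (div_nonneg (by linarith) hT0.le)
    have hi2 : N - 1 < (i + 1) * T := by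
      rw [← div_lt_iff₀ hT0]
      exact Nat.lt_floor_add_one _
    have h1 : {ω | ∀ j ≤ i, W (j * T) ω ∈ O}ᶜ ⊆ AirPCA.entersWithin W R N := by
      intro ω hω
      simp only [Set.mem_compl_iff, Set.mem_ofPred_eq, not_forall] at hω
      obtain ⟨j, hj, hjO⟩ := hω
      refine ⟨j * T, ?_, hRO _ hjO⟩
      have : (j : ℝ) ≤ i := by exact_mod_cast hj
      push_cast
      calc (j : ℝ) * T ≤ i * T := by gcongr
        _ ≤ _ := hi1
    have h2 := measureReal_mono (μ := P) h1
    rw [probReal_compl_eq_one_sub (hAm i)] at h2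
    have h3 := AirPCA.blocks_le_bound hμ hτ0 hγ hL0 hV0 hρ0 hρ1 hB0 hA₀ hm hN hN2 hT2 hi2
    have h4 := hbound i
    linarith
  refine ⟨hmain, ?_, ?_⟩
  · have h1 := AirPCA.tendsto_one_sub_div_atTop (12 * B) (μ * ρ * V)
    refine tendsto_of_tendsto_of_tendsto_of_le_of_le' h1 tendsto_const_nhds ?_
      (Eventually.of_forall fun m => measureReal_le_one)
    filter_upwards [eventually_ge_atTop 1] with m hm
    have := hmain m hm
    rwa [mul_assoc, mul_assoc, ← mul_assoc μ] at this
  · rw [ae_iff]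
    -- Never visiting `R` forces the path into `O` at every checkpoint, so the block bound applies
    -- for all `i`, and its limit shows that this event is null.
    have h1 : ∀ i : ℕ, 1 - 2 * B / ((i + 1) * a) ≤
        1 - P.real {ω | ¬∃ n, W n ω ∈ R} := fun i => by
      have h2 : {ω | ¬∃ n, W n ω ∈ R} ⊆ {ω | ∀ j ≤ i, W (j * T) ω ∈ O} := fun ω hω j _ => by
        by_contra hj
        exact hω ⟨_, hRO _ hj⟩
      linarith [measureReal_mono (μ := P) h2, hbound i]
    have h2 := le_of_tendsto' (AirPCA.tendsto_one_sub_div_atTop (2 * B) a) h1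
    have h3 : P.real {ω | ¬∃ n, W n ω ∈ R} = 0 := le_antisymm (by linarith) measureReal_nonneg
    exact (measureReal_eq_zero_iff).1 h3
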